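/- **Conventions.** Graphs are finite, simple and unweighted. For a graph $G=(V,E)$ and $S\subseteq V$ put $\mu_G(S)=\sum_{v\in S}\deg(v)$ and $\phi_G(S)=|E(S,V\setminus S)|/\mu_G(S)$; the conductance of $G$ is $\phi_G=\min\{\phi_G(S):\emptyset\neq S\subseteq V,\ \mu_G(S)\le \mu_G(V)/2\}$. A subgraph $H\subseteq G$ on the same vertex set is a $k$-spanner of $G$ if $\mathrm{dist}_H(u,v)\le k\cdot\mathrm{dist}_G(u,v)$ for all $u,v$. A tree has depth at most $k$ if, for some choice of root, every vertex is at distance at most $k$ from the root. In the adjacency-list model, an algorithm accesses a graph on vertex set $[n]$ by probes $\mathrm{Deg}(v)$, returning the degree of $v$, and $\mathrm{Nbr}(v,i)$, returning the $i$-th entry of the adjacency list of $v$ (in an arbitrary fixed order), or $\bot$ if there is none. A local computation algorithm (LCA) for edge-membership queries has a finite string $R$ of uniformly random bits, the same for all queries. On a query $(u,v)$ it makes adaptive probes and answers yes or no, in a way that depends only on $R$, $(u,v)$ and the results of the probes made for this query; nothing is remembered between queries. It answers edge-membership queries to a subgraph $T=T(G,R)$ of $G$ if, for every $R$ and every $u,v$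 with $\{u,v\}\in E(G)$, the answer to the query $(u,v)$ is yes exactly when $\{u,v\}\in E(T)$. Its probe complexity is the maximum, over all input graphs and all queries $(u,v)$ with $\{u,v\}\in E(G)$, of the expected number of probes over $R$. Only probes are charged: for given parameters, the algorithm is a randomized decision tree. **Theorem 1.4.** There is a universal constant $C>0$ such that the following holds. For all integers $n\ge 2$ and $d$ and every real $\phi>0$ there is an LCA, depending only on $n$, $d$ and $\phi$, such that for every connected graph $G$ on $[n]$ with maximum degree at most $d$ and conductance $\phi_G\ge\phi$, presented by arbitrary adjacency lists, the LCA answers edge-membership queries to a subgraph $T=([n],E')$ of $G$ with the following properties. 1. With probability at least $1-\frac1n$ over $R$, $T$ is a spanning tree of $G$. 2. Whenever $T$ is a spanning tree, it has depth at most $C\,\frac{\log n}{\phi^2}$ and is a $C\,\frac{\log n}{\phi^2}$-spanner of $G$. 3. For every $u,v$ with $\{u,v\}\in E(G)$, the expected number of probes made to answer the query $(u,v)$ is at most $C\sqrt n\left(\frac{\log^2 n}{\phi^2}+d\right)$. -/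

import Mathlib

/-! ### Volume and conductance -/

section Conductance

/-- The volume of `S`: the total degree of the vertices in `S`. -/
def graphVolume {V : Type*} [Fintype V] [DecidableEq V] (G : SimpleGraph V) [DecidableRel G.Adj]
    (S : Finset V) : ℕ :=
  ∑ v ∈ S, G.degree v

/-- The conductance of a vertex set: the number of edges between `S` and its complement, divided
by the volume of `S`.  (`G.interedges S Sᶜ` holds the pairs `(a, b)` with `a ∈ S`, `b ∉ S` and `a`
adjacent to `b`, so each edge of the cut is counted exactly once.) -/
noncomputable def setConductance {V : Type*} [Fintype V] [DecidableEq V] (G : SimpleGraph V)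
    [DecidableRel G.Adj] (S : Finset V) : ℝ :=
  ((G.interedges S Sᶜ).card : ℝ) / (graphVolume G S : ℝ)

/-- The conductance of a graph: the minimum of the conductances of the nonempty vertex sets whose
volume is at most half of the total volume.  (In a connected graph with at least two vertices there
are such sets, they all have positive volume, and there are finitely many of them, so the infimum is
a genuine minimum.) -/
noncomputable def graphConductance {V : Type*} [Fintype V] [DecidableEq V] (G : SimpleGraph V)
    [DecidableRel G.Adj] : ℝ :=
  sInf {x : ℝ | ∃ S : Finset V, S.Nonempty ∧
    (graphVolume G S : ℝ) ≤ (graphVolume G Finset.univ : ℝ) / 2 ∧ x = setConductance G S}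

end Conductance

/-! ### Depth and stretch -/

section Trees

/-- The (tree) graph `T` has depth at most `k` when rooted at a suitable vertex. -/
def HasDepthAtMost {V : Type*} (T : SimpleGraph V) (k : ℝ) : Prop :=
  ∃ root : V, ∀ v : V, T.Reachable root v ∧ (T.dist root v : ℝ) ≤ k

/-- `H` is a `k`-spanner of `G`: a subgraph in which distances grow by a factor of at most `k`. -/
def IsSpanner {V : Type*} (G H : SimpleGraph V) (k : ℝ) : Prop :=
  H ≤ G ∧ ∀ u v : V, G.Reachable u v →
    H.Reachable u v ∧ (H.dist u v : ℝ) ≤ k * (G.dist u v : ℝ)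

end Trees

/-! ### Adjacency-list probes and local computation algorithms -/

section LCAModel

/-- A representation of `G` by adjacency lists: for each vertex a list of its neighbours, without
repetitions and in arbitrary order. -/
structure AdjacencyLists {n : ℕ} (G : SimpleGraph (Fin n)) where
  list : Fin n → List (Fin n)
  nodup : ∀ v, (list v).Nodup
  mem_iff : ∀ v w, w ∈ list v ↔ G.Adj v w

/-- An adaptive deterministic probing strategy on vertex set `Fin n`, with a yes/no answer: either
it stops with an answer, or it probes `Deg(v)`, or it probes `Nbr(v, i)`, and it continues in a way
that depends only on what the probe returns. -/
inductive ProbeTree (n : ℕ) : Type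
  | answer (b : Bool) : ProbeTree n
  | deg (v : Fin n) (next : ℕ → ProbeTree n) : ProbeTree n
  | nbr (v : Fin n) (i : ℕ) (next : Option (Fin n) → ProbeTree n) : ProbeTree n

/-- The answer that a probing strategy gives on a graph presented by adjacency lists.  `Deg(v)`
returns the degree of `v`; `Nbr(v, i)` returns the `i`-th entry of the list of `v` (counted
from 0), and `none` if there is no such entry. -/
def ProbeTree.eval {n : ℕ} {G : SimpleGraph (Fin n)} (L : AdjacencyLists G) : ProbeTree n → Bool
  | .answer b => b
  | .deg v next => (next (L.list v).length).eval L
  | .nbr v i next => (next (L.list v)[i]?).eval L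

/-- The number of probes that a probing strategy makes on a graph presented by adjacency lists. -/
def ProbeTree.probes {n : ℕ} {G : SimpleGraph (Fin n)} (L : AdjacencyLists G) : ProbeTree n → ℕ
  | .answer _ => 0
  | .deg v next => 1 + (next (L.list v).length).probes L
  | .nbr v i next => 1 + (next (L.list v)[i]?).probes L

/-- A local computation algorithm for edge-membership queries on `n`-vertex graphs, with
adjacency-list probes.  It is given a string of random bits, which is the same for all queries.  The
query `(u, v)` is answered by a probing strategy that depends on the random string and on `(u, v)`
alone, so that nothing is remembered from one query to the next. -/
structure EdgeLCA (n : ℕ) where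
  numBits : ℕ
  strategy : (Fin numBits → Bool) → Fin n → Fin n → ProbeTree n

/-- The probability of an event over a uniformly random string of `m` bits. -/
noncomputable def bitProb (m : ℕ) (P : (Fin m → Bool) → Prop) : ℝ :=
  (Nat.card {R : Fin m → Bool // P R} : ℝ) / 2 ^ m

/-- The expectation of a quantity over a uniformly random string of `m` bits. -/
noncomputable def bitExpect (m : ℕ) (f : (Fin m → Bool) → ℝ) : ℝ :=
  (∑ R : Fin m → Bool, f R) / 2 ^ m

/-- On the input graph `G`, presented by the adjacency lists `L`, the algorithm answers
edge-membership queries to the subgraph `T R` of `G`, where `R` is the random string: for every `R`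
the answers to all queries `(u, v)` with `uv` an edge of `G` are consistent with `T R`. -/
def EdgeLCA.AnswersMembership {n : ℕ} (A : EdgeLCA n) {G : SimpleGraph (Fin n)}
    (L : AdjacencyLists G) (T : (Fin A.numBits → Bool) → SimpleGraph (Fin n)) : Prop :=
  ∀ R : Fin A.numBits → Bool, T R ≤ G ∧
    ∀ u v : Fin n, G.Adj u v → ((A.strategy R u v).eval L = true ↔ (T R).Adj u v)

/-- The expected number of probes, over the random string, made to answer the query `(u, v)`. -/
noncomputable def EdgeLCA.expectedProbes {n : ℕ} (A : EdgeLCA n) {G : SimpleGraph (Fin n)}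
    (L : AdjacencyLists G) (u v : Fin n) : ℝ :=
  bitExpect A.numBits fun R => ((A.strategy R u v).probes L : ℝ)

end LCAModel

/-! Fix the root `0` and let the random string encode about `√n log n` independent lazy random walks
from it, each of length `l` of order `log n / φ²`. Let `W` be the set of visited vertices. A vertex
of `W` other than the root takes as parent its predecessor on a walk that reaches it first; a vertex
outside `W` takes the first vertex on a shortest path to `W`. A query replays all walks, computes
the parents of both endpoints and compares. The parent of a vertex depends only on the random string
and the graph, so all answers are consistent.

The structure is deterministic. Birth time on `W`, and `l` plus the distance to `W` elsewhere, is a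
rank that drops strictly from each vertex to its parent. Hence the parent edges form a spanning tree
for every random string, not just for most of them. The rank is at most `2 * l`, because `l` is at
least the eccentricity of the root; this gives depth and stretch (`exists_tree_of_walks`).

Randomness matters only for the cost of the breadth-first search for `W`. Cheeger's inequality
(`HasExpansion.dirichletForm_ge`) gives geometric decay for the lazy walk, so after `l` steps a walk
ends in any set `B` with probability at least half the stationary one, `vol B / (2 vol V)`. Around
`v` take the smallest ball of volume at least `s = 2 √n d`. Each walk ends in it with probability at
least `1/√n`, so all walks miss it with probability at most `1/n`. If it is hit, the search reads
only lists of vertices in a smaller ball, of volume below `s`; if it is missed, reading the whole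
graph costs `O(n d)`. The expected cost is `O(√n d)`, on top of the `O(√n log² n / φ²)` probes for
the walks.

Random bits cannot give exactly uniform neighbours. A sampler whose density is at most twice the
uniform one is enough, since only expectations of nonnegative costs are needed
(`exists_bitSampler`). -/

/-! ### Cheeger's inequality -/

section Cheeger

set_option linter.unusedSectionVars false

open Finset

variable {V : Type*} [Fintype V] [DecidableEq V] (G : SimpleGraph V) [DecidableRel G.Adj]

/-- The Dirichlet form, summed over ordered pairs of adjacent vertices. -/
def dirichletForm (f : V → ℝ) : ℝ := ∑ x, ∑ y ∈ G.neighborFinset x, (f x - f y) ^ 2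

/-- The squared norm of a function, weighted by the degrees. -/
def degreeNormSq (f : V → ℝ) : ℝ := ∑ x, (G.degree x : ℝ) * f x ^ 2

theorem sum_neighbor_swap (F : V → V → ℝ) :
    ∑ x, ∑ y ∈ G.neighborFinset x, F x y = ∑ x, ∑ y ∈ G.neighborFinset x, F y x := by
  refine Finset.sum_comm' ?_
  intro x y
  simp [SimpleGraph.adj_comm]

theorem sum_neighbor_left (f : V → ℝ) :
    ∑ x, ∑ _y ∈ G.neighborFinset x, f x = ∑ x, (G.degree x : ℝ) * f x := by
  simp

theorem sum_neighbor_right (f : V → ℝ) :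
    ∑ x, ∑ y ∈ G.neighborFinset x, f y = ∑ x, (G.degree x : ℝ) * f x := by
  rw [← sum_neighbor_left, sum_neighbor_swap]

theorem card_interedges_eq_sum (S : Finset V) :
    ((G.interedges S Sᶜ).card : ℝ) =
      ∑ x, ∑ y ∈ G.neighborFinset x, if x ∈ S ∧ y ∉ S then (1 : ℝ) else 0 := by
  have : G.interedges S Sᶜ = (univ ×ˢ univ).filter
      (fun p : V × V => G.Adj p.1 p.2 ∧ (p.1 ∈ S ∧ p.2 ∉ S)) := by
    ext ⟨a, b⟩
    simp [SimpleGraph.mem_interedges_iff]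
    tauto
  rw [this, Finset.card_filter, Nat.cast_sum, Finset.sum_product]
  refine Finset.sum_congr rfl fun x _ => ?_
  rw [SimpleGraph.neighborFinset_eq_filter, Finset.sum_filter]
  refine Finset.sum_congr rfl fun y _ => ?_
  by_cases h : G.Adj x y <;> simp [h]

theorem sum_abs_indicator_sub (S : Finset V) :
    ∑ x, ∑ y ∈ G.neighborFinset x, |(if x ∈ S then (1 : ℝ) else 0) - (if y ∈ S then 1 else 0)|
      = 2 * ((G.interedges S Sᶜ).card : ℝ) := by
  rw [two_mul]
  nth_rewrite 2 [card_interedges_eq_sum]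
  rw [sum_neighbor_swap G (fun x y => if x ∈ S ∧ y ∉ S then (1 : ℝ) else 0),
    card_interedges_eq_sum, ← Finset.sum_add_distrib]
  refine Finset.sum_congr rfl fun x _ => ?_
  rw [← Finset.sum_add_distrib]
  refine Finset.sum_congr rfl fun y _ => ?_
  by_cases hx : x ∈ S <;> by_cases hy : y ∈ S <;> simp [hx, hy]

/-- The isoperimetric inequality for sets of at most half of the volume. -/
def HasExpansion (φ : ℝ) : Prop :=
  ∀ S : Finset V, (graphVolume G S : ℝ) ≤ (graphVolume G univ : ℝ) / 2 →
    φ * graphVolume G S ≤ ((G.interedges S Sᶜ).card : ℝ)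

theorem graphVolume_mono {S T : Finset V} (h : S ⊆ T) : graphVolume G S ≤ graphVolume G T :=
  Finset.sum_le_sum_of_subset h

theorem setConductance_nonneg (S : Finset V) : 0 ≤ setConductance G S := by
  unfold setConductance; positivity

theorem graphConductance_le {S : Finset V} (hS : S.Nonempty)
    (hv : (graphVolume G S : ℝ) ≤ (graphVolume G univ : ℝ) / 2) :
    graphConductance G ≤ setConductance G S := by
  refine csInf_le ⟨0, ?_⟩ ⟨S, hS, hv, rfl⟩
  rintro _ ⟨T, _, _, rfl⟩
  exact setConductance_nonneg G T

theorem hasExpansion_of_le_graphConductance {φ : ℝ} (h : φ ≤ graphConductance G) :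
    HasExpansion G φ := by
  intro S hv
  rcases Nat.eq_zero_or_pos (graphVolume G S) with h0 | h0
  · simp [h0]
  have hne : S.Nonempty := by
    rw [nonempty_iff_ne_empty]
    rintro rfl
    simp [graphVolume] at h0
  have h1 := h.trans (graphConductance_le G hne hv)
  rw [setConductance, le_div_iff₀ (by exact_mod_cast h0)] at h1
  exact h1

theorem card_interedges_le_graphVolume (S : Finset V) :
    ((G.interedges S Sᶜ).card : ℝ) ≤ graphVolume G S := by
  rw [card_interedges_eq_sum, graphVolume, Nat.cast_sum]
  rw [← Finset.sum_subset (Finset.subset_univ S)]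
  · refine Finset.sum_le_sum fun x _ => ?_
    calc _ ≤ ∑ _y ∈ G.neighborFinset x, (1 : ℝ) :=
          Finset.sum_le_sum fun y _ => by split_ifs <;> norm_num
      _ = _ := by simp
  · intro x _ hx
    simp [hx]

theorem setConductance_le_one (S : Finset V) : setConductance G S ≤ 1 :=
  div_le_one_of_le₀ (card_interedges_le_graphVolume G S) (by positivity)

theorem graphVolume_add_compl (S : Finset V) :
    graphVolume G S + graphVolume G Sᶜ = graphVolume G univ :=
  Finset.sum_add_sum_compl S _

theorem graphConductance_le_one [Nontrivial V] : graphConductance G ≤ 1 := by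
  obtain ⟨a, b, hab⟩ := exists_pair_ne V
  have h := graphVolume_add_compl G {a}
  have h' : (graphVolume G {a} : ℝ) + graphVolume G {a}ᶜ = graphVolume G univ := by
    exact_mod_cast h
  rcases le_total (graphVolume G {a} : ℝ) (graphVolume G {a}ᶜ) with h1 | h1
  · exact (graphConductance_le G (singleton_nonempty a) (by linarith)).trans
      (setConductance_le_one G _)
  · exact (graphConductance_le G ⟨b, by simpa using hab.symm⟩ (by linarith)).trans
      (setConductance_le_one G {a}ᶜ)

variable {G}

/-- A discrete co-area argument: subtract from `g` its least positive value `c` on its support `S`.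
Both sides are additive under this splitting, the removed layer `c * 1_S` satisfies the bound by
expansion of `S`, and the remainder has smaller support. The factor 2 appears because ordered pairs
count each cut edge twice. -/
theorem HasExpansion.sum_abs_sub_ge {φ : ℝ} (hG : HasExpansion G φ) (g : V → ℝ)
    (hg : ∀ x, 0 ≤ g x)
    (hv : (graphVolume G (univ.filter fun x => 0 < g x) : ℝ) ≤ (graphVolume G univ : ℝ) / 2) :
    2 * φ * ∑ x, (G.degree x : ℝ) * g x ≤ ∑ x, ∑ y ∈ G.neighborFinset x, |g x - g y| := by
  induction hk : (univ.filter fun x => 0 < g x).card using Nat.strong_induction_on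
    generalizing g with
  | _ k ih =>
  set S := univ.filter fun x => 0 < g x with hS
  have hoff : ∀ x, x ∉ S → g x = 0 := by
    intro x hx
    simp only [hS, mem_filter, mem_univ, true_and, not_lt] at hx
    exact le_antisymm hx (hg x)
  rcases S.eq_empty_or_nonempty with h0 | hne
  · have : ∀ x, g x = 0 := fun x => hoff x (by simp [h0])
    simp [this]
  obtain ⟨z, hz, hmin⟩ := S.exists_min_image g hne
  set c := g z with hc
  have hcpos : 0 < c := by simpa [hS] using hz
  set g' : V → ℝ := fun x => g x - c * (if x ∈ S then 1 else 0) with hg'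
  have hg'0 : ∀ x, 0 ≤ g' x := by
    intro x
    by_cases hx : x ∈ S
    · simp [hg', hx, hmin x hx]
    · simp [hg', hx, hg x]
  have hsub : (univ.filter fun x => 0 < g' x) ⊂ S := by
    refine (Finset.ssubset_iff_of_subset ?_).2 ⟨z, hz, ?_⟩
    · intro x hx
      by_contra hxS
      simp [hg', hxS, hoff x hxS] at hx
    · simp [hg', hz, hc]
  have hrec := ih _ (by rw [← hk]; exact Finset.card_lt_card hsub) g' hg'0
    (le_trans (by exact_mod_cast graphVolume_mono G hsub.subset) hv) rfl
  have habs : ∀ x y, |g x - g y| = |g' x - g' y| +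
      c * |(if x ∈ S then (1 : ℝ) else 0) - (if y ∈ S then 1 else 0)| := by
    intro x y
    by_cases hx : x ∈ S <;> by_cases hy : y ∈ S
    · simp [hg', hx, hy]
    · have := hmin x hx
      simp only [hg', hx, hy, hoff y hy, if_true, if_false, mul_one, mul_zero, sub_zero, abs_one]
      rw [abs_of_nonneg (hg x), abs_of_nonneg (by linarith)]; ring
    · have := hmin y hy
      simp only [hg', hx, hy, hoff x hx, if_true, if_false, mul_one, mul_zero, sub_zero, zero_sub,
        abs_neg, abs_one]
      rw [abs_of_nonneg (hg y), abs_of_nonneg (by linarith)]; ring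
    · simp [hg', hx, hy]
  have hsum : ∑ x, ∑ y ∈ G.neighborFinset x, |g x - g y| =
      ∑ x, ∑ y ∈ G.neighborFinset x, |g' x - g' y| + c * (2 * ((G.interedges S Sᶜ).card : ℝ)) := by
    rw [← sum_abs_indicator_sub, Finset.mul_sum, ← Finset.sum_add_distrib]
    refine Finset.sum_congr rfl fun x _ => ?_
    rw [Finset.mul_sum, ← Finset.sum_add_distrib]
    exact Finset.sum_congr rfl fun y _ => habs x y
  have hdeg : ∑ x, (G.degree x : ℝ) * g x =
      ∑ x, (G.degree x : ℝ) * g' x + c * graphVolume G S := by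
    have : (graphVolume G S : ℝ) = ∑ x, (G.degree x : ℝ) * (if x ∈ S then 1 else 0) := by
      simp [graphVolume]
    rw [this, Finset.mul_sum, ← Finset.sum_add_distrib]
    refine Finset.sum_congr rfl fun x _ => ?_
    simp only [hg']; ring
  have hcut := mul_le_mul_of_nonneg_left (hG S hv) hcpos.le
  rw [hsum, hdeg]
  linarith

/-- Apply the co-area bound to `g ^ 2` and use Cauchy–Schwarz on `|g x ^ 2 - g y ^ 2| = |g x - g y|
* (g x + g y)`. With norm `N` and energy `E` this reads `(2φN)² ≤ E * 4N`. -/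
theorem HasExpansion.dirichletForm_ge_of_support {φ : ℝ} (hφ : 0 ≤ φ) (hG : HasExpansion G φ)
    (g : V → ℝ) (hg : ∀ x, 0 ≤ g x)
    (hv : (graphVolume G (univ.filter fun x => 0 < g x) : ℝ) ≤ (graphVolume G univ : ℝ) / 2) :
    φ ^ 2 * degreeNormSq G g ≤ dirichletForm G g := by
  have h1 := hG.sum_abs_sub_ge (fun x => g x ^ 2) (fun x => by positivity) (by
    have : ∀ x, 0 < g x ^ 2 ↔ 0 < g x := fun x =>
      ⟨fun h => lt_of_le_of_ne (hg x) (fun h' => by simp [← h'] at h), fun h => by positivity⟩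
    simpa only [this] using hv)
  have hN0 : 0 ≤ degreeNormSq G g := Finset.sum_nonneg fun x _ => by positivity
  have hE0 : 0 ≤ dirichletForm G g :=
    Finset.sum_nonneg fun x _ => Finset.sum_nonneg fun y _ => by positivity
  change 2 * φ * degreeNormSq G g ≤ _ at h1
  have h2 : (∑ x, ∑ y ∈ G.neighborFinset x, |g x ^ 2 - g y ^ 2|) ^ 2 ≤
      dirichletForm G g * (4 * degreeNormSq G g) := by
    have h3 : ∑ x, ∑ y ∈ G.neighborFinset x, (g x + g y) ^ 2 ≤ 4 * degreeNormSq G g := by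
      calc _ ≤ ∑ x, ∑ y ∈ G.neighborFinset x, (2 * g x ^ 2 + 2 * g y ^ 2) :=
            Finset.sum_le_sum fun x _ => Finset.sum_le_sum fun y _ => by
              nlinarith [sq_nonneg (g x - g y)]
        _ = _ := by
            simp only [Finset.sum_add_distrib, ← Finset.mul_sum]
            rw [sum_neighbor_left G (fun x => g x ^ 2), sum_neighbor_right G (fun x => g x ^ 2)]
            unfold degreeNormSq; ring
    refine le_trans ?_ (mul_le_mul_of_nonneg_left h3 hE0)
    unfold dirichletForm
    rw [Finset.sum_sigma', Finset.sum_sigma', Finset.sum_sigma']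
    have hcs := Finset.sum_mul_sq_le_sq_mul_sq (univ.sigma fun x => G.neighborFinset x)
      (fun p => |g p.1 - g p.2|) (fun p => g p.1 + g p.2)
    simp only [sq_abs] at hcs
    refine le_trans (le_of_eq ?_) hcs
    congr 1
    refine Finset.sum_congr rfl fun p _ => ?_
    rw [sq_sub_sq, abs_mul, abs_of_nonneg (add_nonneg (hg _) (hg _)), mul_comm]
  rcases hN0.eq_or_lt with h0 | h0
  · rw [← h0]; simpa using hE0
  have h4 : (2 * φ * degreeNormSq G g) ^ 2 ≤ dirichletForm G g * (4 * degreeNormSq G g) :=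
    (pow_le_pow_left₀ (by positivity) h1 2).trans h2
  have h5 : (φ ^ 2 * degreeNormSq G g) * (4 * degreeNormSq G g) ≤
      dirichletForm G g * (4 * degreeNormSq G g) := by linarith
  exact le_of_mul_le_mul_right h5 (by positivity)

variable (G) in
-- Take the largest value of `f` with at most half of the volume strictly below it. If more than
-- half lay strictly above, the next larger value would qualify as well. Cutting at such a `c` makes
-- both parts of `f - c` eligible for the expansion hypothesis.
theorem exists_volume_median [Nonempty V] (f : V → ℝ) : ∃ c : ℝ,
    (graphVolume G (univ.filter fun x => f x < c) : ℝ) ≤ (graphVolume G univ : ℝ) / 2 ∧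
    (graphVolume G (univ.filter fun x => c < f x) : ℝ) ≤ (graphVolume G univ : ℝ) / 2 := by
  set A := univ.filter fun z : V =>
    (graphVolume G (univ.filter fun x => f x < f z) : ℝ) ≤ (graphVolume G univ : ℝ) / 2 with hA
  obtain ⟨z₀, -, hz₀⟩ := (univ : Finset V).exists_min_image f univ_nonempty
  have hne : A.Nonempty := by
    refine ⟨z₀, ?_⟩
    have : (univ.filter fun x => f x < f z₀) = ∅ := by
      ext x; simpa using hz₀ x (mem_univ x)
    simp only [hA, mem_filter, mem_univ, true_and, this]
    simp [graphVolume]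
    positivity
  obtain ⟨z, hz, hmax⟩ := A.exists_max_image f hne
  refine ⟨f z, by simpa [hA] using hz, ?_⟩
  by_contra hcon
  push Not at hcon
  have hne' : (univ.filter fun x => f z < f x).Nonempty := by
    rw [nonempty_iff_ne_empty]
    intro h
    rw [h] at hcon
    have : (0 : ℝ) ≤ (graphVolume G univ : ℝ) / 2 := by positivity
    simp [graphVolume] at hcon this
    linarith
  obtain ⟨y, hy, hymin⟩ := (univ.filter fun x => f z < f x).exists_min_image f hne'
  have hyz : f z < f y := by simpa using hy
  have hsub : (univ.filter fun x => f x < f y) ⊆ (univ.filter fun x => f z < f x)ᶜ := by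
    intro x hx
    simp only [mem_filter, mem_univ, true_and] at hx
    simp only [mem_compl]
    intro hx'
    exact absurd (hymin x hx') (not_le.2 hx)
  have h1 : (graphVolume G (univ.filter fun x => f x < f y) : ℝ) ≤
      graphVolume G (univ.filter fun x => f z < f x)ᶜ := by
    exact_mod_cast graphVolume_mono G hsub
  have h2 : (graphVolume G (univ.filter fun x => f z < f x) : ℝ) +
      graphVolume G (univ.filter fun x => f z < f x)ᶜ = graphVolume G univ := by
    exact_mod_cast graphVolume_add_compl G _
  have : y ∈ A := by
    simp only [hA, mem_filter, mem_univ, true_and]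
    linarith
  exact absurd (hmax y this) (not_le.2 hyz)

/-- Cheeger's inequality. -/
theorem HasExpansion.dirichletForm_ge {φ : ℝ} (hφ : 0 ≤ φ) (hG : HasExpansion G φ)
    (f : V → ℝ) (hf : ∑ x, (G.degree x : ℝ) * f x = 0) :
    φ ^ 2 * degreeNormSq G f ≤ dirichletForm G f := by
  rcases isEmpty_or_nonempty V with h | h
  · simp [degreeNormSq, dirichletForm]
  obtain ⟨c, hlo, hhi⟩ := exists_volume_median G f
  have hp := hG.dirichletForm_ge_of_support hφ (fun x => max (f x - c) 0)
    (fun x => le_max_right _ _) (by simpa using hhi)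
  have hm := hG.dirichletForm_ge_of_support hφ (fun x => max (c - f x) 0)
    (fun x => le_max_right _ _) (by simpa using hlo)
  -- Across an edge whose ends lie on the same side of `c`, one part carries the whole difference;
  -- otherwise the difference is split as `a + b` with `a, b ≥ 0`, and `a² + b² ≤ (a + b)²`.
  have hE : dirichletForm G (fun x => max (f x - c) 0) + dirichletForm G (fun x => max (c - f x) 0)
      ≤ dirichletForm G f := by
    unfold dirichletForm
    rw [← Finset.sum_add_distrib]
    refine Finset.sum_le_sum fun x _ => ?_
    rw [← Finset.sum_add_distrib]
    refine Finset.sum_le_sum fun y _ => ?_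
    dsimp only
    rcases le_total (f x) c with hx | hx <;> rcases le_total (f y) c with hy | hy
    · rw [max_eq_right (by linarith), max_eq_right (by linarith), max_eq_left (by linarith),
        max_eq_left (by linarith)]; nlinarith
    · rw [max_eq_right (by linarith), max_eq_left (by linarith), max_eq_left (by linarith),
        max_eq_right (by linarith)]; nlinarith [mul_nonneg (sub_nonneg.2 hx) (sub_nonneg.2 hy)]
    · rw [max_eq_left (by linarith), max_eq_right (by linarith), max_eq_right (by linarith),
        max_eq_left (by linarith)]; nlinarith [mul_nonneg (sub_nonneg.2 hx) (sub_nonneg.2 hy)]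
    · rw [max_eq_left (by linarith), max_eq_left (by linarith), max_eq_right (by linarith),
        max_eq_right (by linarith)]; nlinarith
  -- The two parts have disjoint supports, so their norms add up to that of `f - c`; since `f` has
  -- mean zero, shifting it by a constant can only increase the norm.
  have hN : degreeNormSq G f ≤
      degreeNormSq G (fun x => max (f x - c) 0) + degreeNormSq G (fun x => max (c - f x) 0) := by
    have h1 : degreeNormSq G (fun x => max (f x - c) 0) + degreeNormSq G (fun x => max (c - f x) 0)
        = degreeNormSq G f - 2 * c * ∑ x, (G.degree x : ℝ) * f x +
          c ^ 2 * ∑ x, (G.degree x : ℝ) := by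
      unfold degreeNormSq
      rw [Finset.mul_sum, Finset.mul_sum, ← Finset.sum_add_distrib, ← Finset.sum_sub_distrib,
        ← Finset.sum_add_distrib]
      refine Finset.sum_congr rfl fun x _ => ?_
      dsimp only
      rcases le_total (f x) c with hx | hx
      · rw [max_eq_right (by linarith), max_eq_left (by linarith)]; ring
      · rw [max_eq_left (by linarith), max_eq_right (by linarith)]; ring
    rw [h1, hf]
    have : 0 ≤ c ^ 2 * ∑ x, (G.degree x : ℝ) :=
      mul_nonneg (sq_nonneg c) (Finset.sum_nonneg fun x _ => by positivity)
    linarith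
  calc φ ^ 2 * degreeNormSq G f ≤ φ ^ 2 * _ := mul_le_mul_of_nonneg_left hN (sq_nonneg φ)
    _ ≤ _ := by linarith

end Cheeger

/-! ### Mixing of the lazy random walk -/

section LazyWalk

set_option linter.unusedSectionVars false

open Finset

variable {V : Type*} [Fintype V] [DecidableEq V] (G : SimpleGraph V) [DecidableRel G.Adj]

/-- The transition operator of the lazy random walk. -/
noncomputable def lazyWalkOp (f : V → ℝ) (x : V) : ℝ :=
  (f x + (∑ y ∈ G.neighborFinset x, f y) / G.degree x) / 2

theorem lazyWalkOp_sub_const (hdeg : ∀ x, 0 < G.degree x) (f : V → ℝ) (c : ℝ) :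
    lazyWalkOp G (fun x => f x - c) = fun x => lazyWalkOp G f x - c := by
  funext x
  have : (G.degree x : ℝ) ≠ 0 := by exact_mod_cast (hdeg x).ne'
  simp only [lazyWalkOp, Finset.sum_sub_distrib, Finset.sum_const,
    SimpleGraph.card_neighborFinset_eq_degree, nsmul_eq_mul]
  field_simp
  ring

theorem iterate_lazyWalkOp_sub_const (hdeg : ∀ x, 0 < G.degree x) (f : V → ℝ) (c : ℝ) (t : ℕ) :
    (lazyWalkOp G)^[t] (fun x => f x - c) = fun x => (lazyWalkOp G)^[t] f x - c := by
  induction t generalizing f with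
  | zero => rfl
  | succ t ih => rw [Function.iterate_succ_apply, lazyWalkOp_sub_const G hdeg, ih]; rfl

theorem sum_degree_mul_lazyWalkOp (hdeg : ∀ x, 0 < G.degree x) (f : V → ℝ) :
    ∑ x, (G.degree x : ℝ) * lazyWalkOp G f x = ∑ x, (G.degree x : ℝ) * f x := by
  have : ∀ x, (G.degree x : ℝ) * lazyWalkOp G f x =
      ((G.degree x : ℝ) * f x + ∑ y ∈ G.neighborFinset x, f y) / 2 := by
    intro x
    have : (G.degree x : ℝ) ≠ 0 := by exact_mod_cast (hdeg x).ne'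
    unfold lazyWalkOp
    field_simp
  simp only [this]
  rw [← Finset.sum_div, Finset.sum_add_distrib, sum_neighbor_right]
  ring

/-- Laziness makes the operator an average over incident edges of the midpoints `(f x + f y) / 2`.
Cauchy–Schwarz at each vertex and the parallelogram identity on each edge then give the loss, with
no separate control of negative eigenvalues. -/
theorem degreeNormSq_lazyWalkOp_le (hdeg : ∀ x, 0 < G.degree x) (f : V → ℝ) :
    degreeNormSq G (lazyWalkOp G f) ≤ degreeNormSq G f - dirichletForm G f / 4 := by
  have h1 : degreeNormSq G (lazyWalkOp G f) ≤
      ∑ x, ∑ y ∈ G.neighborFinset x, ((f x + f y) / 2) ^ 2 := by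
    refine Finset.sum_le_sum fun x _ => ?_
    have hd : (0 : ℝ) < G.degree x := by exact_mod_cast hdeg x
    have hop : lazyWalkOp G f x = (∑ y ∈ G.neighborFinset x, (f x + f y) / 2) / G.degree x := by
      rw [← Finset.sum_div, Finset.sum_add_distrib, Finset.sum_const,
        SimpleGraph.card_neighborFinset_eq_degree, nsmul_eq_mul]
      unfold lazyWalkOp
      field_simp
    have hcs := sq_sum_le_card_mul_sum_sq (s := G.neighborFinset x) (f := fun y => (f x + f y) / 2)
    rw [SimpleGraph.card_neighborFinset_eq_degree] at hcs
    rw [hop, div_pow, ← mul_div_assoc, div_le_iff₀ (by positivity)]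
    calc _ ≤ _ := mul_le_mul_of_nonneg_left hcs hd.le
      _ = _ := by ring
  have h2 : ∑ x, ∑ y ∈ G.neighborFinset x, ((f x + f y) / 2) ^ 2 =
      degreeNormSq G f - dirichletForm G f / 4 := by
    have : ∀ x y, ((f x + f y) / 2) ^ 2 = f x ^ 2 / 2 + f y ^ 2 / 2 - (f x - f y) ^ 2 / 4 := by
      intro x y; ring
    simp only [this, Finset.sum_sub_distrib, Finset.sum_add_distrib, ← Finset.sum_div]
    rw [sum_neighbor_left G (fun x => f x ^ 2), sum_neighbor_right G (fun x => f x ^ 2)]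
    unfold degreeNormSq dirichletForm; ring
  exact h1.trans h2.le

variable {G}

theorem HasExpansion.degreeNormSq_iterate_le {φ : ℝ} (hφ : 0 ≤ φ) (hφ1 : φ ≤ 1)
    (hG : HasExpansion G φ) (hdeg : ∀ x, 0 < G.degree x) (f : V → ℝ)
    (hf : ∑ x, (G.degree x : ℝ) * f x = 0) (t : ℕ) :
    degreeNormSq G ((lazyWalkOp G)^[t] f) ≤ (1 - φ ^ 2 / 4) ^ t * degreeNormSq G f := by
  induction t generalizing f with
  | zero => simp
  | succ t ih =>
    have h1 := ih (lazyWalkOp G f) (by rw [sum_degree_mul_lazyWalkOp G hdeg, hf])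
    have h2 := degreeNormSq_lazyWalkOp_le G hdeg f
    have h3 := hG.dirichletForm_ge hφ f hf
    have h4 : 0 ≤ 1 - φ ^ 2 / 4 := by nlinarith
    rw [Function.iterate_succ_apply, pow_succ, mul_assoc]
    exact h1.trans (mul_le_mul_of_nonneg_left (by linarith) (pow_nonneg h4 t))

/-- The lazy walk from any vertex hits a set with at least half of its stationary probability, once
the length of the walk exceeds the relaxation time by a logarithmic factor. -/
theorem HasExpansion.iterate_lazyWalkOp_indicator_ge {φ : ℝ} (hφ : 0 ≤ φ) (hφ1 : φ ≤ 1)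
    (hG : HasExpansion G φ) (hdeg : ∀ x, 0 < G.degree x) (t : ℕ)
    (ht : (1 - φ ^ 2 / 4) ^ t * (4 * (graphVolume G univ : ℝ) ^ 3) ≤ 1) (B : Finset V)
    (r : V) :
    (graphVolume G B : ℝ) / (2 * graphVolume G univ) ≤
      (lazyWalkOp G)^[t] (fun x => if x ∈ B then 1 else 0) r := by
  rcases B.eq_empty_or_nonempty with rfl | ⟨b, hb⟩
  · have : (fun x : V => if x ∈ (∅ : Finset V) then (1 : ℝ) else 0) = fun _ => 0 := by simp
    rw [this]
    have h0 : ∀ t, (lazyWalkOp G)^[t] (fun _ => (0 : ℝ)) = fun _ => 0 := by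
      intro t
      induction t with
      | zero => rfl
      | succ t ih =>
        rw [Function.iterate_succ_apply]
        have : lazyWalkOp G (fun _ => (0 : ℝ)) = fun _ => 0 := by funext x; simp [lazyWalkOp]
        rw [this, ih]
    simp [h0, graphVolume]
  set M : ℝ := (graphVolume G univ : ℝ) with hM
  set β : ℝ := (graphVolume G B : ℝ) with hβ
  have hβ1 : 1 ≤ β := by
    have : 1 ≤ graphVolume G B := (hdeg b).trans_le
      (Finset.single_le_sum (f := fun v => G.degree v) (fun _ _ => Nat.zero_le _) hb)
    rw [hβ]; exact_mod_cast this
  have hβM : β ≤ M := by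
    rw [hβ, hM]; exact_mod_cast graphVolume_mono G (subset_univ B)
  have hM0 : 0 < M := by linarith
  set ind : V → ℝ := fun x => if x ∈ B then 1 else 0 with hind
  set p := β / M with hp
  have hp0 : 0 < p := by positivity
  have hp1 : p ≤ 1 := (div_le_one hM0).2 hβM
  have hmean : ∑ x, (G.degree x : ℝ) * (ind x - p) = 0 := by
    have h1 : ∑ x, (G.degree x : ℝ) * ind x = β := by simp [hind, hβ, graphVolume]
    have h2 : ∑ x, (G.degree x : ℝ) = M := by simp [hM, graphVolume]
    simp only [mul_sub, Finset.sum_sub_distrib, ← Finset.sum_mul]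
    rw [h1, h2, hp]; field_simp; ring
  have hdecay := hG.degreeNormSq_iterate_le hφ hφ1 hdeg (fun x => ind x - p) hmean t
  have hN0 : degreeNormSq G (fun x => ind x - p) ≤ M := by
    rw [hM, graphVolume, Nat.cast_sum]
    refine Finset.sum_le_sum fun x _ => ?_
    have : (ind x - p) ^ 2 ≤ 1 := by
      by_cases hx : x ∈ B <;> simp only [hind, hx, if_true, if_false] <;> nlinarith
    nlinarith [(Nat.cast_nonneg (G.degree x) : (0 : ℝ) ≤ G.degree x)]
  rw [iterate_lazyWalkOp_sub_const G hdeg] at hdecay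
  set F := (lazyWalkOp G)^[t] ind with hF
  have hpt : (F r - p) ^ 2 ≤ degreeNormSq G (fun x => F x - p) := by
    have h1 : (G.degree r : ℝ) * (F r - p) ^ 2 ≤ degreeNormSq G (fun x => F x - p) :=
      Finset.single_le_sum (f := fun x => (G.degree x : ℝ) * (F x - p) ^ 2)
        (fun _ _ => by positivity) (mem_univ r)
    have h2 : (1 : ℝ) ≤ G.degree r := by exact_mod_cast hdeg r
    nlinarith [sq_nonneg (F r - p)]
  have hq0 : 0 ≤ (1 - φ ^ 2 / 4) ^ t := pow_nonneg (by nlinarith) t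
  -- The factor `4 * M ^ 3` in `ht` is chosen for this step: one `M` bounds the initial norm, and `1
  -- / (4 * M ^ 2)` is at most `(p / 2) ^ 2` because `β ≥ 1`.
  have hsq : (F r - p) ^ 2 ≤ (p / 2) ^ 2 := by
    have h1 : (F r - p) ^ 2 ≤ (1 - φ ^ 2 / 4) ^ t * M :=
      hpt.trans (hdecay.trans (mul_le_mul_of_nonneg_left hN0 hq0))
    have h2 : (1 - φ ^ 2 / 4) ^ t * M ≤ 1 / (4 * M ^ 2) := by
      rw [le_div_iff₀ (by positivity)]; linarith
    have h3 : 1 / (4 * M ^ 2) ≤ (p / 2) ^ 2 := by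
      have : (p / 2) ^ 2 = β ^ 2 / (4 * M ^ 2) := by rw [hp]; field_simp; ring
      rw [this]
      gcongr
      nlinarith
    linarith
  have h5 := abs_le_of_sq_le_sq' hsq (by positivity)
  have h6 : β / (2 * M) = p / 2 := by rw [hp]; field_simp
  rw [h6]; linarith [h5.1]

end LazyWalk

/-! ### Trees from parent functions that decrease a rank -/

section ParentTree

variable {V : Type*}

/-- The graph that joins every vertex other than the root `r` to its parent. -/
def parentGraph (r : V) (par : V → V) : SimpleGraph V :=
  SimpleGraph.fromRel fun u v => u ≠ r ∧ par u = v

theorem parentGraph_adj {r : V} {par : V → V} {u v : V} :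
    (parentGraph r par).Adj u v ↔ u ≠ v ∧ ((u ≠ r ∧ par u = v) ∨ (v ≠ r ∧ par v = u)) :=
  SimpleGraph.fromRel_adj _ _ _

variable {r : V} {par : V → V} {rank : V → ℕ}

theorem parentGraph_exists_walk (h : ∀ v, v ≠ r → rank (par v) < rank v) (v : V) :
    ∃ p : (parentGraph r par).Walk r v, p.length ≤ rank v := by
  induction hk : rank v using Nat.strong_induction_on generalizing v with
  | _ k ih =>
  by_cases hv : v = r
  · subst hv
    exact ⟨.nil, by simp⟩
  have h1 := h v hv
  obtain ⟨p, hp⟩ := ih _ (hk ▸ h1) (par v) rfl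
  have hadj : (parentGraph r par).Adj (par v) v :=
    parentGraph_adj.2 ⟨fun e => by rw [e] at h1; exact lt_irrefl _ h1, Or.inr ⟨hv, rfl⟩⟩
  refine ⟨p.concat hadj, ?_⟩
  rw [SimpleGraph.Walk.length_concat]
  omega

theorem parentGraph_dist_le (h : ∀ v, v ≠ r → rank (par v) < rank v) (v : V) :
    (parentGraph r par).dist r v ≤ rank v := by
  obtain ⟨p, hp⟩ := parentGraph_exists_walk h v
  exact (SimpleGraph.dist_le p).trans hp

theorem parentGraph_connected (h : ∀ v, v ≠ r → rank (par v) < rank v) :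
    (parentGraph r par).Connected := by
  have : Nonempty V := ⟨r⟩
  refine ⟨fun u v => ?_⟩
  obtain ⟨p, -⟩ := parentGraph_exists_walk h u
  obtain ⟨q, -⟩ := parentGraph_exists_walk h v
  exact ⟨p.reverse.append q⟩

/-- Every edge is `s(v, par v)` for some `v ≠ r`, so there are at most `|V| - 1` edges; a connected
graph with so few edges is a tree. -/
theorem parentGraph_isTree [Finite V] (h : ∀ v, v ≠ r → rank (par v) < rank v) :
    (parentGraph r par).IsTree := by
  have hc := parentGraph_connected h
  refine SimpleGraph.isTree_iff_connected_and_card.2 ⟨hc, ?_⟩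
  refine le_antisymm ?_ hc.card_vert_le_card_edgeSet_add_one
  have h1 : (parentGraph r par).edgeSet ⊆ (fun v => s(v, par v)) '' {v | v ≠ r} := by
    intro e he
    induction e using Sym2.ind with
    | _ u v =>
      rcases (parentGraph_adj.1 ((SimpleGraph.mem_edgeSet _).1 he)).2 with ⟨hu, hp⟩ | ⟨hv, hp⟩
      · exact ⟨u, hu, by simp only [hp]⟩
      · exact ⟨v, hv, by simp only [hp]; exact Sym2.eq_swap⟩
  have h2 : (parentGraph r par).edgeSet.ncard ≤ {v | v ≠ r}.ncard :=
    (Set.ncard_le_ncard h1 (Set.toFinite _)).trans (Set.ncard_image_le (Set.toFinite _))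
  have h3 : {v | v ≠ r}.ncard + 1 = Nat.card V := by
    have := Set.ncard_add_ncard_compl {r}
    rw [Set.ncard_singleton, add_comm] at this
    exact this
  rw [Nat.card_coe_set_eq]
  omega

theorem parentGraph_le {G : SimpleGraph V} (hG : ∀ v, v ≠ r → G.Adj v (par v)) :
    parentGraph r par ≤ G := by
  intro u v huv
  rcases (parentGraph_adj.1 huv).2 with ⟨hu, rfl⟩ | ⟨hv, rfl⟩
  · exact hG u hu
  · exact (hG v hv).symm

theorem parentGraph_hasDepthAtMost (h : ∀ v, v ≠ r → rank (par v) < rank v) {k : ℝ}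
    (hk : ∀ v, (rank v : ℝ) ≤ k) : HasDepthAtMost (parentGraph r par) k :=
  ⟨r, fun v => ⟨(parentGraph_connected h).preconnected r v,
    le_trans (by exact_mod_cast parentGraph_dist_le h v) (hk v)⟩⟩

/-- The detour through the root has length at most the sum of the two ranks, and distinct vertices
are at distance at least 1 in `G`. -/
theorem parentGraph_isSpanner {G : SimpleGraph V} (hG : ∀ v, v ≠ r → G.Adj v (par v))
    (h : ∀ v, v ≠ r → rank (par v) < rank v) {k : ℝ} (hk : ∀ v, 2 * (rank v : ℝ) ≤ k) :
    IsSpanner G (parentGraph r par) k := by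
  have hc := parentGraph_connected h
  have hk0 : 0 ≤ k := le_trans (by positivity) (hk r)
  refine ⟨parentGraph_le hG, fun u v huv => ⟨hc.preconnected u v, ?_⟩⟩
  by_cases e : u = v
  · subst e
    simp
  have h1 : 1 ≤ G.dist u v := huv.pos_dist_of_ne e
  have h2 : (parentGraph r par).dist u v ≤ rank u + rank v := by
    refine (hc.dist_triangle (v := r)).trans ?_
    rw [SimpleGraph.dist_comm]
    exact add_le_add (parentGraph_dist_le h u) (parentGraph_dist_le h v)
  have h3 : ((parentGraph r par).dist u v : ℝ) ≤ rank u + rank v := by exact_mod_cast h2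
  have h4 : (1 : ℝ) ≤ G.dist u v := by exact_mod_cast h1
  nlinarith [hk u, hk v]

end ParentTree

/-! ### Almost uniform sampling from random bits -/

section UniformSampling

open Finset

/-- Reduction modulo a divisor preserves uniformity. This serves both the bit sampler and the choice
of a random list position. -/
theorem sum_range_mul_mod (c q : ℕ) (F : ℕ → ℝ) :
    ∑ k ∈ range (c * q), F (k % c) = q * ∑ i ∈ range c, F i := by
  induction q with
  | zero => simp
  | succ q ih =>
    rw [Nat.mul_succ, sum_range_add, ih]
    have : ∀ i ∈ range c, F ((c * q + i) % c) = F i := by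
      intro i hi
      rw [Nat.mul_add_mod, Nat.mod_eq_of_lt (mem_range.1 hi)]
    rw [sum_congr rfl this]
    push_cast
    ring

/-- Every finite type is the image of the uniform distribution on some bit strings, with
probabilities that are at most twice the uniform ones. -/
theorem exists_bitSampler (α : Type*) [Fintype α] [Nonempty α] :
    ∃ (m : ℕ) (f : (Fin m → Bool) → α), ∀ g : α → ℝ, (∀ a, 0 ≤ g a) →
      bitExpect m (fun R => g (f R)) ≤ 2 * ((∑ a, g a) / Fintype.card α) := by
  set c := Fintype.card α with hc
  have hc0 : 0 < c := Fintype.card_pos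
  set N := 2 ^ c with hN
  have hcN : c ≤ N := Nat.lt_two_pow_self.le
  let e : (Fin c → Bool) ≃ Fin N := Fintype.equivFinOfCardEq (by simp [hN])
  let a : α ≃ Fin c := Fintype.equivFinOfCardEq hc.symm
  refine ⟨c, fun R => a.symm ⟨e R % c, Nat.mod_lt _ hc0⟩, fun g hg => ?_⟩
  let F : ℕ → ℝ := fun i => if h : i < c then g (a.symm ⟨i, h⟩) else 0
  have hF0 : ∀ i, 0 ≤ F i := by
    intro i
    simp only [F]
    split_ifs
    · exact hg _
    · exact le_rfl
  have h1 : ∑ R : Fin c → Bool, g (a.symm ⟨e R % c, Nat.mod_lt _ hc0⟩) =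
      ∑ k ∈ range N, F (k % c) := by
    rw [← Fin.sum_univ_eq_sum_range (fun k => F (k % c)) N]
    refine Fintype.sum_equiv e _ _ fun R => ?_
    simp [F, Nat.mod_lt _ hc0]
  have h2 : ∑ x, g x = ∑ i ∈ range c, F i := by
    rw [← Fin.sum_univ_eq_sum_range F c]
    refine Fintype.sum_equiv a _ _ fun x => ?_
    simp [F]
  -- Each residue is hit at most `N / c + 1` times. Since `c ≤ N`, this is at most twice the average
  -- `N / c`, which is the source of the factor 2.
  have h3 : ∑ k ∈ range N, F (k % c) ≤ ((N / c + 1 : ℕ) : ℝ) * ∑ i ∈ range c, F i := by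
    rw [← sum_range_mul_mod]
    refine sum_le_sum_of_subset_of_nonneg (range_subset_range.2 ?_) fun i _ _ => hF0 _
    exact (Nat.lt_mul_div_succ N hc0).le
  have hS : 0 ≤ ∑ i ∈ range c, F i := sum_nonneg fun i _ => hF0 i
  have hcr : (0 : ℝ) < c := by exact_mod_cast hc0
  have hNr : (0 : ℝ) < N := by exact_mod_cast hc0.trans_le hcN
  have h4 : ((N / c + 1 : ℕ) : ℝ) ≤ 2 * (N / c) := by
    have h5 : ((N / c : ℕ) : ℝ) ≤ (N : ℝ) / c := Nat.cast_div_le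
    have h6 : (1 : ℝ) ≤ (N : ℝ) / c := (one_le_div hcr).2 (by exact_mod_cast hcN)
    push_cast
    linarith
  unfold bitExpect
  have hN' : (2 : ℝ) ^ c = N := by simp [hN]
  rw [h1, h2, hN', div_le_iff₀ hNr]
  refine h3.trans ((mul_le_mul_of_nonneg_right h4 hS).trans (le_of_eq ?_))
  field_simp

end UniformSampling

/-! ### Probing routines in continuation-passing style -/

section Routines

open Finset

variable {n : ℕ}

namespace ProbeTree

/-- Reads the first `i` entries of the adjacency list of `v`. -/
def readPrefix (v : Fin n) : ℕ → (List (Fin n) → ProbeTree n) → ProbeTree n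
  | 0, k => k []
  | i + 1, k => readPrefix v i fun l => .nbr v i fun o => k (l ++ o.toList)

/-- Reads the adjacency list of `v`. -/
def readNeighbors (v : Fin n) (k : List (Fin n) → ProbeTree n) : ProbeTree n :=
  .deg v fun δ => readPrefix v δ k

/-- Reads the adjacency lists of several vertices. -/
def readAll : List (Fin n) → ((Fin n → List (Fin n)) → ProbeTree n) → ProbeTree n
  | [], k => k fun _ => []
  | x :: xs, k => readAll xs fun M => readNeighbors x fun l => k (Function.update M x l)

/-- One step of a lazy walk: stay, or move along an entry of the adjacency list. -/
def lazyStep {N : ℕ} (x : Fin n) (s : Bool × Fin N) (k : Fin n → ProbeTree n) : ProbeTree n :=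
  if s.1 then k x else .deg x fun δ => .nbr x (s.2 % δ) fun o => k (o.getD x)

/-- Follows a lazy walk, and passes on the list of the vertices that it visits. -/
def lazyWalk {N : ℕ} : Fin n → List (Bool × Fin N) → (List (Fin n) → ProbeTree n) → ProbeTree n
  | x, [], k => k [x]
  | x, s :: ss, k => lazyStep x s fun y => lazyWalk y ss fun l => k (x :: l)

/-- Follows several lazy walks from the same vertex. -/
def lazyWalks {N : ℕ} (r : Fin n) :
    List (List (Bool × Fin N)) → (List (List (Fin n)) → ProbeTree n) → ProbeTree n
  | [], k => k []
  | w :: ws, k => lazyWalk r w fun l => lazyWalks r ws fun ls => k (l :: ls)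

open Classical in
/-- Continues a breadth-first search until it meets `W`.  The search has visited `vis`, the last
layer is `front`, and `hop y` is the first vertex on the way to a vertex `y` of that layer. -/
noncomputable def bfs (W : Set (Fin n)) : ℕ → Finset (Fin n) → Finset (Fin n) →
    (Fin n → Fin n) → (Fin n → ProbeTree n) → Fin n → ProbeTree n
  | 0, _, _, _, k, v => k v
  | fuel + 1, vis, front, hop, k, v =>
    if h : ∃ x ∈ front, x ∈ W then k (hop h.choose)
    else readAll front.toList fun M =>
      bfs W fuel (vis ∪ univ.filter fun y => ∃ x ∈ front, y ∈ M x)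
        (univ.filter fun y => y ∉ vis ∧ ∃ x ∈ front, y ∈ M x)
        (fun y => if h : ∃ x ∈ front, y ∈ M x then hop h.choose else y) k v

/-- Finds the first vertex on a shortest path from `v` to `W`. -/
noncomputable def firstHop (W : Set (Fin n)) (fuel : ℕ) (v : Fin n) (k : Fin n → ProbeTree n) :
    ProbeTree n :=
  readNeighbors v fun l => bfs W fuel (insert v l.toFinset) l.toFinset id k v

variable {G : SimpleGraph (Fin n)} (L : AdjacencyLists G)

/-- Whatever the continuation is, the routine `p` passes `a` on to it, after at most `c` probes. -/
def Returns {α : Type*} (p : (α → ProbeTree n) → ProbeTree n) (a : α) (c : ℕ) : Prop :=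
  ∀ k, (p k).eval L = (k a).eval L ∧ (p k).probes L ≤ c + (k a).probes L

variable {L}

/-- Because `Returns` quantifies over all continuations, results chain and probe bounds add. All
later cost estimates are assembled this way. -/
theorem Returns.bind {α β : Type*} {p : (α → ProbeTree n) → ProbeTree n} {a : α} {c : ℕ}
    {q : α → (β → ProbeTree n) → ProbeTree n} {b : β} {c' : ℕ}
    (hp : Returns L p a c) (hq : Returns L (q a) b c') :
    Returns L (fun k => p fun x => q x k) b (c + c') := fun k =>
  ⟨(hp _).1.trans (hq k).1, (hp _).2.trans (by have := (hq k).2; omega)⟩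

theorem Returns.map {α β : Type*} {p : (α → ProbeTree n) → ProbeTree n} {a : α} {c : ℕ}
    (hp : Returns L p a c) (f : α → β) : Returns L (fun k => p fun x => k (f x)) (f a) c :=
  fun _ => hp _

theorem Returns.mono {α : Type*} {p : (α → ProbeTree n) → ProbeTree n} {a : α} {c c' : ℕ}
    (hp : Returns L p a c) (h : c ≤ c') : Returns L p a c' :=
  fun k => ⟨(hp k).1, (hp k).2.trans (by omega)⟩

theorem returns_pure {α : Type*} (a : α) : Returns L (fun k => k a) a 0 :=
  fun _ => ⟨rfl, by simp⟩

variable (L)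

theorem returns_deg (v : Fin n) : Returns L (.deg v) (L.list v).length 1 :=
  fun _ => ⟨rfl, le_rfl⟩

theorem returns_nbr (v : Fin n) (i : ℕ) : Returns L (.nbr v i) (L.list v)[i]? 1 :=
  fun _ => ⟨rfl, le_rfl⟩

theorem returns_readPrefix (v : Fin n) (i : ℕ) :
    Returns L (readPrefix v i) ((L.list v).take i) i := by
  induction i with
  | zero => exact returns_pure []
  | succ i ih =>
    rw [List.take_add_one]
    exact ih.bind (q := fun l k => .nbr v i fun o => k (l ++ o.toList))
      ((returns_nbr L v i).map fun o => (L.list v).take i ++ o.toList)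

theorem returns_readNeighbors (v : Fin n) :
    Returns L (readNeighbors v) (L.list v) ((L.list v).length + 1) := by
  have h := returns_readPrefix L v (L.list v).length
  rw [List.take_length] at h
  rw [add_comm]
  exact (returns_deg L v).bind (q := fun δ k => readPrefix v δ k) h

theorem returns_readAll (xs : List (Fin n)) :
    Returns L (readAll xs) (fun y => if y ∈ xs then L.list y else [])
      (xs.map fun x => (L.list x).length + 1).sum := by
  induction xs with
  | nil =>
    have h : (fun y => if y ∈ ([] : List (Fin n)) then L.list y else []) = fun _ => [] := by simp
    rw [h]
    exact returns_pure _
  | cons x xs ih =>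
    have h : (fun y => if y ∈ x :: xs then L.list y else []) =
        Function.update (fun y => if y ∈ xs then L.list y else []) x (L.list x) := by
      funext y
      by_cases e : y = x
      · subst e; simp
      · simp [e]
    rw [h, List.map_cons, List.sum_cons, add_comm]
    exact ih.bind (q := fun M k => readNeighbors x fun l => k (Function.update M x l))
      ((returns_readNeighbors L x).map _)

/-- The vertex that a lazy walk step leads to. -/
def _root_.AdjacencyLists.step {N : ℕ} (x : Fin n) (s : Bool × Fin N) : Fin n :=
  if s.1 then x else ((L.list x)[s.2 % (L.list x).length]?).getD x

/-- The vertices that a lazy walk visits. -/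
def _root_.AdjacencyLists.trace {N : ℕ} : Fin n → List (Bool × Fin N) → List (Fin n)
  | x, [] => [x]
  | x, s :: ss => x :: AdjacencyLists.trace (L.step x s) ss

theorem returns_lazyStep {N : ℕ} (x : Fin n) (s : Bool × Fin N) :
    Returns L (lazyStep x s) (L.step x s) 2 := by
  obtain ⟨b, i⟩ := s
  cases b
  · exact (returns_deg L x).bind (q := fun δ k => .nbr x (i % δ) fun o => k (o.getD x))
      ((returns_nbr L x _).map fun o => o.getD x)
  · exact (returns_pure x).mono (by norm_num)

theorem returns_lazyWalk {N : ℕ} (x : Fin n) (ss : List (Bool × Fin N)) :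
    Returns L (lazyWalk x ss) (L.trace x ss) (2 * ss.length) := by
  induction ss generalizing x with
  | nil => exact returns_pure [x]
  | cons s ss ih =>
    rw [List.length_cons, mul_add, mul_one, add_comm]
    exact (returns_lazyStep L x s).bind (q := fun y k => lazyWalk y ss fun l => k (x :: l))
      ((ih _).map _)

theorem returns_lazyWalks {N : ℕ} (r : Fin n) (ws : List (List (Bool × Fin N))) :
    Returns L (lazyWalks r ws) (ws.map (L.trace r)) (ws.map fun w => 2 * w.length).sum := by
  induction ws with
  | nil => exact returns_pure []
  | cons w ws ih =>
    rw [List.map_cons, List.map_cons, List.sum_cons]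
    exact (returns_lazyWalk L r w).bind (q := fun l k => lazyWalks r ws fun ls => k (l :: ls))
      (ih.map _)

variable {L}

theorem _root_.SimpleGraph.Connected.exists_adj_dist_eq {V : Type*} {G : SimpleGraph V}
    (hG : G.Connected) {v y : V} {j : ℕ} (h : G.dist v y = j + 1) :
    ∃ x, G.Adj x y ∧ G.dist v x = j := by
  obtain ⟨p, hp⟩ := hG.exists_walk_length_eq_dist y v
  rw [SimpleGraph.dist_comm, h] at hp
  cases p with
  | nil => simp at hp
  | @cons _ x _ hyx q =>
    refine ⟨x, hyx.symm, ?_⟩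
    rw [SimpleGraph.Walk.length_cons] at hp
    have h1 := SimpleGraph.dist_le q
    have h2 := hG.dist_triangle (u := v) (v := x) (w := y)
    rw [SimpleGraph.dist_comm] at h1
    rw [SimpleGraph.dist_eq_one_iff_adj.2 hyx.symm] at h2
    omega

end ProbeTree

end Routines

/-! ### Correctness and cost of the breadth-first search -/

section BreadthFirstSearch

open Finset

variable {n : ℕ} {G : SimpleGraph (Fin n)} (L : AdjacencyLists G)

theorem AdjacencyLists.toFinset_list [DecidableRel G.Adj] (v : Fin n) :
    (L.list v).toFinset = G.neighborFinset v := by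
  ext w
  simp [L.mem_iff]

theorem AdjacencyLists.length_list [DecidableRel G.Adj] (v : Fin n) :
    (L.list v).length = G.degree v := by
  rw [← List.toFinset_card_of_nodup (L.nodup v), L.toFinset_list,
    SimpleGraph.card_neighborFinset_eq_degree]

/-- The total number of probes that read the adjacency lists of the vertices at distance at least
`i` and less than `j` from `v`. -/
noncomputable def annulusCost (G : SimpleGraph (Fin n)) [DecidableRel G.Adj] (v : Fin n)
    (i j : ℕ) : ℕ :=
  ∑ x with i ≤ G.dist v x ∧ G.dist v x < j, (G.degree x + 1)

namespace ProbeTree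

/-- Invariant: `vis` is the ball of radius `j` around `v`, `front` is the sphere, and `hop y` is a
neighbour of `v` on a shortest path to `y`. A layer is compared with `W` before its lists are read,
and this comparison needs no probe. So the layer at distance `m` is never paid for, which is what
later keeps the cost below the volume of a smaller ball. -/
theorem returns_bfs [DecidableRel G.Adj] (hG : G.Connected) {W : Set (Fin n)} {v : Fin n} {m : ℕ}
    (hex : ∃ x ∈ W, G.dist v x = m)
    (fuel j : ℕ) (hj : j ≤ m) (hfuel : m < j + fuel) (vis front : Finset (Fin n))
    (hop : Fin n → Fin n) (hvis : ∀ x, x ∈ vis ↔ G.dist v x ≤ j)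
    (hfront : ∀ x, x ∈ front ↔ G.dist v x = j)
    (hhop : ∀ y ∈ front, G.Adj v (hop y) ∧ G.dist (hop y) y + 1 ≤ j) :
    ∃ h, G.Adj v h ∧ (∃ w ∈ W, G.dist h w + 1 ≤ m) ∧
      Returns L (fun k => bfs W fuel vis front hop k v) h (annulusCost G v j m) := by
  induction fuel generalizing j vis front hop with
  | zero => omega
  | succ fuel ih =>
    by_cases hW : ∃ x ∈ front, x ∈ W
    · have hc := hW.choose_spec
      have h1 := hhop _ hc.1
      refine ⟨hop hW.choose, h1.1, ⟨_, hc.2, h1.2.trans hj⟩, ?_⟩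
      simp only [bfs, dif_pos hW]
      exact (returns_pure _).mono (Nat.zero_le _)
    · have hjm : j < m := by
        refine lt_of_le_of_ne hj fun e => hW ?_
        obtain ⟨x, hx, hd⟩ := hex
        exact ⟨x, (hfront x).2 (hd.trans e.symm), hx⟩
      simp only [bfs, dif_neg hW]
      set M : Fin n → List (Fin n) := fun y => if y ∈ front.toList then L.list y else [] with hM
      have hnext : ∀ y, (∃ x ∈ front, y ∈ M x) ↔ ∃ x, G.dist v x = j ∧ G.Adj x y := by
        intro y
        refine exists_congr fun x => ?_
        rw [hfront x]
        refine and_congr_right fun hx => ?_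
        simp [hM, hfront, hx, L.mem_iff]
      have hle : ∀ x y, G.dist v x = j → G.Adj x y → G.dist v y ≤ j + 1 := by
        intro x y hx hxy
        have := hG.dist_triangle (u := v) (v := x) (w := y)
        rw [SimpleGraph.dist_eq_one_iff_adj.2 hxy, hx] at this
        exact this
      obtain ⟨h, h1, h2, h3⟩ := ih (j + 1) hjm (by omega)
        (vis ∪ univ.filter fun y => ∃ x ∈ front, y ∈ M x)
        (univ.filter fun y => y ∉ vis ∧ ∃ x ∈ front, y ∈ M x)
        (fun y => if h : ∃ x ∈ front, y ∈ M x then hop h.choose else y)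
        (by
          intro y
          simp only [mem_union, mem_filter, mem_univ, true_and, hvis, hnext]
          constructor
          · rintro (h | ⟨x, hx, hxy⟩)
            · omega
            · exact hle x y hx hxy
          · intro h
            rcases Nat.lt_or_ge j (G.dist v y) with h' | h'
            · obtain ⟨x, hxy, hx⟩ := hG.exists_adj_dist_eq (v := v) (y := y) (j := j) (by omega)
              exact Or.inr ⟨x, hx, hxy⟩
            · exact Or.inl h')
        (by
          intro y
          simp only [mem_filter, mem_univ, true_and, hvis, hnext, not_le]
          constructor
          · rintro ⟨h, x, hx, hxy⟩
            have := hle x y hx hxy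
            omega
          · intro h
            obtain ⟨x, hxy, hx⟩ := hG.exists_adj_dist_eq h
            exact ⟨by omega, x, hx, hxy⟩)
        (by
          intro y hy
          have hex' : ∃ x ∈ front, y ∈ M x := by
            simp only [mem_filter, mem_univ, true_and] at hy
            exact hy.2
          simp only [dif_pos hex']
          have hc := hex'.choose_spec
          have hadj : G.Adj hex'.choose y := by
            have h4 := hc.2
            simp only [hM] at h4
            rw [if_pos (mem_toList.2 hc.1)] at h4
            exact (L.mem_iff _ _).1 h4
          have h5 := hhop _ hc.1
          refine ⟨h5.1, ?_⟩
          have h6 := hG.dist_triangle (u := hop hex'.choose) (v := hex'.choose) (w := y)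
          rw [SimpleGraph.dist_eq_one_iff_adj.2 hadj] at h6
          omega)
      refine ⟨h, h1, h2, ?_⟩
      refine ((returns_readAll L front.toList).bind (q := fun M k => bfs W fuel
        (vis ∪ univ.filter fun y => ∃ x ∈ front, y ∈ M x)
        (univ.filter fun y => y ∉ vis ∧ ∃ x ∈ front, y ∈ M x)
        (fun y => if h : ∃ x ∈ front, y ∈ M x then hop h.choose else y) k v) h3).mono ?_
      rw [Finset.sum_map_toList]
      simp only [L.length_list]
      have hf : front = univ.filter fun x => G.dist v x = j := by
        ext x; simp [hfront]
      rw [hf, annulusCost, annulusCost, sum_filter, sum_filter, sum_filter, ← sum_add_distrib]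
      refine sum_le_sum fun x _ => ?_
      split_ifs <;> omega

/-- The search started at a vertex `v` outside `W` returns a neighbour of `v` that is closer to `W`,
and it reads only the adjacency lists of the vertices that are closer to `v` than `W` is. -/
theorem returns_firstHop [DecidableRel G.Adj] (hG : G.Connected) {W : Set (Fin n)} {v : Fin n}
    {m : ℕ} (hm : 1 ≤ m) (hex : ∃ x ∈ W, G.dist v x = m)
    {fuel : ℕ} (hfuel : m ≤ fuel) :
    ∃ h, G.Adj v h ∧ (∃ w ∈ W, G.dist h w + 1 ≤ m) ∧
      Returns L (firstHop W fuel v) h (annulusCost G v 0 m) := by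
  obtain ⟨h, h1, h2, h3⟩ := returns_bfs L hG hex fuel 1 hm (by omega)
    (insert v (L.list v).toFinset) (L.list v).toFinset id
    (by
      intro x
      simp only [mem_insert, List.mem_toFinset, L.mem_iff, ← SimpleGraph.dist_eq_one_iff_adj]
      have : x = v ↔ G.dist v x = 0 := by
        rw [hG.dist_eq_zero_iff, eq_comm]
      rw [this]
      omega)
    (by
      intro x
      rw [List.mem_toFinset, L.mem_iff, SimpleGraph.dist_eq_one_iff_adj])
    (by
      intro y hy
      rw [List.mem_toFinset, L.mem_iff] at hy
      simp [hy])
  refine ⟨h, h1, h2, ?_⟩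
  refine ((returns_readNeighbors L v).bind (q := fun l k => bfs W fuel (insert v l.toFinset)
    l.toFinset id k v) h3).mono ?_
  -- Reading the list of `v` itself pays for layer 0; the search pays for the layers from 1 on.
  have hv : (L.list v).length + 1 =
      ∑ x : Fin n, if x = v then G.degree x + 1 else 0 := by
    rw [Finset.sum_ite_eq']
    simp [L.length_list]
  rw [hv, annulusCost, annulusCost, sum_filter, sum_filter, ← sum_add_distrib]
  refine sum_le_sum fun x _ => ?_
  by_cases e : x = v
  · subst e
    have h0 : G.dist x x = 0 := SimpleGraph.dist_self
    rw [if_pos rfl, if_neg (by omega), if_pos (by omega), add_zero]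
  · simp only [e, if_false]
    split_ifs <;> omega

end ProbeTree

end BreadthFirstSearch

/-! ### First visits and predecessors on the walks -/

section WalkParent

variable {V : Type*}

/-- The first time at which some walk of the collection visits `v`. -/
noncomputable def birthTime (ws : List (List V)) (v : V) : ℕ :=
  sInf {t | ∃ w ∈ ws, w[t]? = some v}

open Classical in
/-- The predecessor of `v` on a walk that is among the first to visit `v`. -/
noncomputable def walkParent (ws : List (List V)) (v : V) : V :=
  if h : ∃ p, ∃ w ∈ ws, ∃ t, t + 1 = birthTime ws v ∧ w[t + 1]? = some v ∧ w[t]? = some p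
  then h.choose else v

/-- A list of vertices that starts at `r` and follows the edges of `G` or stays. -/
def IsLazyTrace (G : SimpleGraph V) (r : V) (w : List V) : Prop :=
  w[0]? = some r ∧ ∀ t v, w[t + 1]? = some v → ∃ u, w[t]? = some u ∧ (u = v ∨ G.Adj u v)

theorem birthTime_le {ws : List (List V)} {v : V} {w : List V} (hw : w ∈ ws) {t : ℕ}
    (ht : w[t]? = some v) : birthTime ws v ≤ t :=
  Nat.sInf_le ⟨w, hw, ht⟩

theorem exists_getElem_birthTime {ws : List (List V)} {v : V} (hv : ∃ w ∈ ws, v ∈ w) :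
    ∃ w ∈ ws, w[birthTime ws v]? = some v := by
  obtain ⟨w, hw, hvw⟩ := hv
  obtain ⟨t, ht⟩ := List.mem_iff_getElem?.1 hvw
  exact Nat.sInf_mem (s := {t | ∃ w ∈ ws, w[t]? = some v}) ⟨t, w, hw, ht⟩

theorem birthTime_le_of_length {ws : List (List V)} {v : V} {l : ℕ}
    (hl : ∀ w ∈ ws, w.length ≤ l + 1) (hv : ∃ w ∈ ws, v ∈ w) : birthTime ws v ≤ l := by
  obtain ⟨w, hw, h⟩ := exists_getElem_birthTime hv
  have h1 := (List.getElem?_eq_some_iff.1 h).1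
  have := hl w hw
  omega

/-- All walks start at `r`, so `v ≠ r` has positive birth time and thus a predecessor on a walk that
attains it. The predecessor was visited earlier than `v`, hence differs from `v`, and so the step
between them was a move along an edge and not a stay. -/
theorem walkParent_spec {G : SimpleGraph V} {r : V} {ws : List (List V)}
    (hws : ∀ w ∈ ws, IsLazyTrace G r w) {v : V} (hv : ∃ w ∈ ws, v ∈ w) (hr : v ≠ r) :
    G.Adj v (walkParent ws v) ∧ (∃ w ∈ ws, walkParent ws v ∈ w) ∧
      birthTime ws (walkParent ws v) < birthTime ws v := by
  have hex : ∃ p, ∃ w ∈ ws, ∃ t, t + 1 = birthTime ws v ∧ w[t + 1]? = some v ∧ w[t]? = some p := by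
    obtain ⟨w, hw, h⟩ := exists_getElem_birthTime hv
    rcases hb : birthTime ws v with _ | t
    · rw [hb, (hws w hw).1] at h
      exact absurd (Option.some.inj h).symm hr
    · rw [hb] at h
      obtain ⟨u, hu, -⟩ := (hws w hw).2 t v h
      exact ⟨u, w, hw, t, rfl, h, hu⟩
  have hp : walkParent ws v = hex.choose := by rw [walkParent, dif_pos hex]
  obtain ⟨w, hw, t, ht, h1, h2⟩ := hex.choose_spec
  rw [← hp] at h2
  have hlt : birthTime ws (walkParent ws v) < birthTime ws v := by
    have := birthTime_le hw h2
    omega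
  refine ⟨?_, ⟨w, hw, List.mem_of_getElem? h2⟩, hlt⟩
  obtain ⟨u, hu, h3⟩ := (hws w hw).2 t v h1
  rw [h2] at hu
  rw [Option.some.inj hu] at hlt ⊢
  rcases h3 with h3 | h3
  · rw [h3] at hlt
    exact absurd hlt (lt_irrefl _)
  · exact h3.symm

variable {n : ℕ} {G : SimpleGraph (Fin n)} (L : AdjacencyLists G)

theorem AdjacencyLists.step_eq_or_adj {N : ℕ} (x : Fin n) (s : Bool × Fin N) :
    x = L.step x s ∨ G.Adj x (L.step x s) := by
  unfold AdjacencyLists.step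
  split_ifs
  · exact Or.inl rfl
  · cases h : (L.list x)[(s.2 : ℕ) % (L.list x).length]? with
    | none => exact Or.inl rfl
    | some y => exact Or.inr ((L.mem_iff x y).1 (List.mem_of_getElem? h))

theorem AdjacencyLists.isLazyTrace_trace {N : ℕ} (r : Fin n) (ss : List (Bool × Fin N)) :
    IsLazyTrace G r (L.trace r ss) := by
  induction ss generalizing r with
  | nil => exact ⟨rfl, fun t v h => by simp [trace] at h⟩
  | cons s ss ih =>
    refine ⟨rfl, fun t v h => ?_⟩
    have h' : (L.trace (L.step r s) ss)[t]? = some v := h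
    cases t with
    | zero =>
      rw [(ih _).1] at h'
      refine ⟨r, rfl, ?_⟩
      rw [← Option.some.inj h']
      exact L.step_eq_or_adj r s
    | succ t => exact (ih _).2 t v h'

theorem AdjacencyLists.length_trace {N : ℕ} (r : Fin n) (ss : List (Bool × Fin N)) :
    (L.trace r ss).length = ss.length + 1 := by
  induction ss generalizing r with
  | nil => rfl
  | cons s ss ih => simp [trace, ih]

theorem AdjacencyLists.foldl_mem_trace {N : ℕ} (r : Fin n) (ss : List (Bool × Fin N)) :
    ss.foldl L.step r ∈ L.trace r ss := by
  induction ss generalizing r with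
  | nil => simp [trace]
  | cons s ss ih => exact List.mem_cons_of_mem _ (ih _)

theorem AdjacencyLists.dist_foldl_le (hG : G.Connected) {N : ℕ} (r : Fin n)
    (ss : List (Bool × Fin N)) : G.dist r (ss.foldl L.step r) ≤ ss.length := by
  induction ss generalizing r with
  | nil => simp
  | cons s ss ih =>
    have h1 := hG.dist_triangle (u := r) (v := L.step r s) (w := ss.foldl L.step (L.step r s))
    have h2 : G.dist r (L.step r s) ≤ 1 := by
      rcases L.step_eq_or_adj r s with h | h
      · rw [← h]; simp
      · exact (SimpleGraph.dist_eq_one_iff_adj.2 h).le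
    have h3 := ih (L.step r s)
    rw [List.foldl_cons, List.length_cons]
    omega

end WalkParent

/-! ### The tree defined by the walks -/

section WalkTree

open Finset

variable {n : ℕ}

/-- The vertices on a collection of walks. -/
def walkSupport (ws : List (List (Fin n))) : Set (Fin n) := {x | ∃ w ∈ ws, x ∈ w}

/-- The distance from a vertex to a set. -/
noncomputable def distToSet (G : SimpleGraph (Fin n)) (W : Set (Fin n)) (v : Fin n) : ℕ :=
  sInf (G.dist v '' W)

theorem distToSet_le {G : SimpleGraph (Fin n)} {W : Set (Fin n)} (v : Fin n) {x : Fin n}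
    (hx : x ∈ W) : distToSet G W v ≤ G.dist v x :=
  Nat.sInf_le ⟨x, hx, rfl⟩

theorem exists_dist_eq_distToSet (G : SimpleGraph (Fin n)) {W : Set (Fin n)} (hW : W.Nonempty)
    (v : Fin n) : ∃ x ∈ W, G.dist v x = distToSet G W v :=
  Nat.sInf_mem (hW.image (G.dist v))

theorem distToSet_pos {G : SimpleGraph (Fin n)} (hG : G.Connected) {W : Set (Fin n)}
    (hW : W.Nonempty) {v : Fin n} (hv : v ∉ W) : 1 ≤ distToSet G W v := by
  obtain ⟨x, hx, h⟩ := exists_dist_eq_distToSet G hW v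
  rw [← h]
  exact hG.pos_dist_of_ne fun e => hv (e ▸ hx)

namespace ProbeTree

open Classical in
/-- Finds the parent of `v` in the tree that is spanned by the walks `ws` and by shortest paths to
these walks. -/
noncomputable def findParent (ws : List (List (Fin n))) (fuel : ℕ) (v : Fin n)
    (k : Fin n → ProbeTree n) : ProbeTree n :=
  if v ∈ walkSupport ws then k (walkParent ws v) else firstHop (walkSupport ws) fuel v k

/-- Decides whether `uv` is an edge of the tree with root `r` that is determined by the walks with
steps `ss`. -/
noncomputable def treeQuery {N : ℕ} (r : Fin n) (fuel : ℕ) (ss : List (List (Bool × Fin N)))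
    (u v : Fin n) : ProbeTree n :=
  lazyWalks r ss fun ws => findParent ws fuel u fun p => findParent ws fuel v fun q =>
    .answer (decide ((u ≠ r ∧ p = v) ∨ (v ≠ r ∧ q = u)))

end ProbeTree

open Classical in
/-- The birth time on the walks, extended by the distance to the walks. -/
noncomputable def treeRank (G : SimpleGraph (Fin n)) (ws : List (List (Fin n))) (l : ℕ)
    (v : Fin n) : ℕ :=
  if v ∈ walkSupport ws then birthTime ws v else l + distToSet G (walkSupport ws) v

variable {G : SimpleGraph (Fin n)} (L : AdjacencyLists G)

/-- Birth times are at most `l`, while ranks off the walks exceed `l`; so the rank also drops where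
a shortest path enters the walks. Fuel `l` suffices for the search because the root lies on the
walks. -/
theorem exists_parent_of_walks [DecidableRel G.Adj] (hG : G.Connected) {r : Fin n} {l : ℕ}
    {ws : List (List (Fin n))} (hws : ∀ w ∈ ws, IsLazyTrace G r w)
    (hlen : ∀ w ∈ ws, w.length ≤ l + 1) (hr : r ∈ walkSupport ws) (hd : ∀ v, G.dist r v ≤ l)
    (v : Fin n) :
    ∃ p, (v ≠ r → G.Adj v p ∧ treeRank G ws l p < treeRank G ws l v) ∧
      ProbeTree.Returns L (ProbeTree.findParent ws l v) p
        (annulusCost G v 0 (distToSet G (walkSupport ws) v)) := by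
  by_cases hv : v ∈ walkSupport ws
  · refine ⟨walkParent ws v, fun hvr => ?_, ?_⟩
    · obtain ⟨h1, h2, h3⟩ := walkParent_spec hws hv hvr
      have h2' : walkParent ws v ∈ walkSupport ws := h2
      refine ⟨h1, ?_⟩
      rw [treeRank, treeRank, if_pos hv, if_pos h2']
      exact h3
    · have : ProbeTree.findParent ws l v = fun k => k (walkParent ws v) := by
        funext k
        rw [ProbeTree.findParent, if_pos hv]
      rw [this]
      exact (ProbeTree.returns_pure _).mono (Nat.zero_le _)
  · have hpos := distToSet_pos hG ⟨r, hr⟩ hv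
    have hle : distToSet G (walkSupport ws) v ≤ l := by
      refine (distToSet_le v hr).trans ?_
      rw [SimpleGraph.dist_comm]
      exact hd v
    obtain ⟨p, h1, ⟨w, hw, h2⟩, h3⟩ := ProbeTree.returns_firstHop L hG hpos
      (exists_dist_eq_distToSet G ⟨r, hr⟩ v) hle
    refine ⟨p, fun _ => ⟨h1, ?_⟩, ?_⟩
    · rw [treeRank, treeRank, if_neg hv]
      split_ifs with hp
      · have := birthTime_le_of_length hlen hp
        omega
      · have := distToSet_le (G := G) p hw
        omega
    · have : ProbeTree.findParent ws l v = ProbeTree.firstHop (walkSupport ws) l v := by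
        funext k
        rw [ProbeTree.findParent, if_neg hv]
      rw [this]
      exact h3

theorem treeRank_le {r : Fin n} {l : ℕ} {ws : List (List (Fin n))}
    (hlen : ∀ w ∈ ws, w.length ≤ l + 1) (hr : r ∈ walkSupport ws) (hd : ∀ v, G.dist r v ≤ l)
    (v : Fin n) : treeRank G ws l v ≤ 2 * l := by
  unfold treeRank
  split_ifs with hv
  · have := birthTime_le_of_length hlen hv
    omega
  · have := distToSet_le (G := G) v hr
    rw [SimpleGraph.dist_comm] at this
    have := hd v
    omega

/-- The tree that is determined by a nonempty collection of walks whose length is at least the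
eccentricity of the root, and the cost of queries to it. -/
theorem exists_tree_of_walks [DecidableRel G.Adj] (hG : G.Connected) {N : ℕ} {r : Fin n} {l : ℕ}
    {ss : List (List (Bool × Fin N))} (hne : ss ≠ []) (hlen : ∀ s ∈ ss, s.length = l)
    (hd : ∀ v, G.dist r v ≤ l) :
    ∃ T : SimpleGraph (Fin n), T ≤ G ∧ T.IsTree ∧
      (∀ k : ℝ, 4 * (l : ℝ) ≤ k → HasDepthAtMost T k ∧ IsSpanner G T k) ∧
      ∀ u v, G.Adj u v →
        ((ProbeTree.treeQuery r l ss u v).eval L = true ↔ T.Adj u v) ∧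
        (ProbeTree.treeQuery r l ss u v).probes L ≤ 2 * l * ss.length +
          annulusCost G u 0 (distToSet G (walkSupport (ss.map (L.trace r))) u) +
          annulusCost G v 0 (distToSet G (walkSupport (ss.map (L.trace r))) v) := by
  set ws := ss.map (L.trace r) with hws
  have h1 : ∀ w ∈ ws, IsLazyTrace G r w := by
    intro w hw
    obtain ⟨s, -, rfl⟩ := List.mem_map.1 hw
    exact L.isLazyTrace_trace r s
  have h2 : ∀ w ∈ ws, w.length ≤ l + 1 := by
    intro w hw
    obtain ⟨s, hs, rfl⟩ := List.mem_map.1 hw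
    rw [L.length_trace, hlen s hs]
  have hr : r ∈ walkSupport ws := by
    obtain ⟨s, hs⟩ := List.exists_mem_of_ne_nil ss hne
    exact ⟨_, List.mem_map_of_mem hs, List.mem_of_getElem? (L.isLazyTrace_trace r s).1⟩
  choose par hpar hret using exists_parent_of_walks L hG h1 h2 hr hd
  have hrank : ∀ v, v ≠ r → treeRank G ws l (par v) < treeRank G ws l v := fun v h => (hpar v h).2
  have hadj : ∀ v, v ≠ r → G.Adj v (par v) := fun v h => (hpar v h).1
  have hle := treeRank_le (G := G) h2 hr hd
  refine ⟨parentGraph r par, parentGraph_le hadj, parentGraph_isTree hrank, fun k hk => ⟨?_, ?_⟩,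
    fun u v huv => ?_⟩
  · refine parentGraph_hasDepthAtMost hrank fun v => ?_
    have : (treeRank G ws l v : ℝ) ≤ 2 * l := by exact_mod_cast hle v
    linarith [(Nat.cast_nonneg l : (0 : ℝ) ≤ l)]
  -- The constant 4: ranks are at most `2 * l`, and a detour uses two paths to the root.
  · refine parentGraph_isSpanner hadj hrank fun v => ?_
    have : (treeRank G ws l v : ℝ) ≤ 2 * l := by exact_mod_cast hle v
    linarith
  · have hwalks := ProbeTree.returns_lazyWalks L r ss
    have hcost : (ss.map fun w => 2 * w.length).sum = 2 * l * ss.length := by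
      rw [List.map_congr_left (g := fun _ => 2 * l) fun s hs => by rw [hlen s hs]]
      simp [mul_comm]
    rw [hcost] at hwalks
    have hq := hwalks fun ws => ProbeTree.findParent ws l u fun p =>
      ProbeTree.findParent ws l v fun q =>
        .answer (decide ((u ≠ r ∧ p = v) ∨ (v ≠ r ∧ q = u)))
    have hu := hret u fun p => ProbeTree.findParent ws l v fun q =>
        .answer (decide ((u ≠ r ∧ p = v) ∨ (v ≠ r ∧ q = u)))
    have hv := hret v fun q =>
        .answer (decide ((u ≠ r ∧ par u = v) ∨ (v ≠ r ∧ q = u)))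
    refine ⟨?_, ?_⟩
    · rw [ProbeTree.treeQuery, hq.1, ← hws, hu.1, hv.1, parentGraph_adj]
      simp [ProbeTree.eval, huv.ne]
    · refine hq.2.trans ?_
      rw [add_assoc]
      refine Nat.add_le_add_left (hu.2.trans (Nat.add_le_add_left ?_ _)) _
      exact hv.2

end WalkTree

/-! ### Hitting probabilities and expected search cost -/

section WalkDistribution

open Finset

variable {n : ℕ} {G : SimpleGraph (Fin n)} (L : AdjacencyLists G) [DecidableRel G.Adj]

theorem sum_range_length_getD {V : Type*} (l : List V) (x : V) (f : V → ℝ) :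
    ∑ j ∈ range l.length, f (l[j]?.getD x) = (l.map f).sum := by
  induction l with
  | nil => simp
  | cons a l ih =>
    rw [List.length_cons, sum_range_succ', List.map_cons, List.sum_cons, add_comm, ← ih]
    simp

/-- Since the degree divides `N`, a uniform index modulo the degree is a uniform position in the
list; the Boolean supplies the laziness. -/
theorem AdjacencyLists.sum_step {N : ℕ} {x : Fin n} (hx : 0 < G.degree x) (hN : G.degree x ∣ N)
    (f : Fin n → ℝ) :
    ∑ s : Bool × Fin N, f (L.step x s) = 2 * N * lazyWalkOp G f x := by
  obtain ⟨q, rfl⟩ := hN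
  have hd : (G.degree x : ℝ) ≠ 0 := by exact_mod_cast hx.ne'
  have h1 : ∑ i : Fin (G.degree x * q), f (L.step x (false, i)) =
      q * ∑ y ∈ G.neighborFinset x, f y := by
    rw [← L.toFinset_list, List.sum_toFinset f (L.nodup x), ← sum_range_length_getD _ x,
      L.length_list, ← sum_range_mul_mod, ← Fin.sum_univ_eq_sum_range
        (fun k => f ((L.list x)[k % G.degree x]?.getD x))]
    refine sum_congr rfl fun i _ => ?_
    simp [AdjacencyLists.step, L.length_list]
  rw [Fintype.sum_prod_type, Fintype.sum_bool, h1]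
  simp only [AdjacencyLists.step, if_true, sum_const, card_univ, Fintype.card_fin, nsmul_eq_mul]
  unfold lazyWalkOp
  push_cast
  field_simp

theorem AdjacencyLists.sum_foldl_step {N : ℕ} (hdeg : ∀ x, 0 < G.degree x)
    (hN : ∀ x, G.degree x ∣ N) (f : Fin n → ℝ) (t : ℕ) (x : Fin n) :
    ∑ w : Fin t → Bool × Fin N, f ((List.ofFn w).foldl L.step x) =
      (2 * N) ^ t * (lazyWalkOp G)^[t] f x := by
  induction t generalizing x with
  | zero => simp
  | succ t ih =>
    rw [← (Fin.consEquiv fun _ : Fin (t + 1) => Bool × Fin N).sum_comp, Fintype.sum_prod_type]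
    have h : ∀ s : Bool × Fin N, ∑ w : Fin t → Bool × Fin N,
        f ((List.ofFn (Fin.consEquiv (fun _ : Fin (t + 1) => Bool × Fin N) (s, w))).foldl L.step x)
        = (2 * N) ^ t * (lazyWalkOp G)^[t] f (L.step x s) := by
      intro s
      rw [← ih]
      refine sum_congr rfl fun w _ => ?_
      simp [Fin.consEquiv, List.ofFn_succ]
    rw [sum_congr rfl fun s _ => h s, ← mul_sum, L.sum_step (hdeg x) (hN x),
      Function.iterate_succ_apply', pow_succ]
    ring

/-- A walk of `t` steps from `r` hits every set with half of its stationary probability. -/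
def IsMixingTime (G : SimpleGraph (Fin n)) [DecidableRel G.Adj] (r : Fin n) (t : ℕ) : Prop :=
  ∀ B : Finset (Fin n), (graphVolume G B : ℝ) / (2 * graphVolume G univ) ≤
    (lazyWalkOp G)^[t] (fun x => if x ∈ B then 1 else 0) r

variable {L}

/-- A singleton has positive volume, so some walk of `t` steps ends at `v`. Thus mixing alone bounds
the eccentricity of `r`. Here `N` is an auxiliary common multiple of the degrees. -/
theorem IsMixingTime.dist_le (L : AdjacencyLists G) (hG : G.Connected)
    (hdeg : ∀ x, 0 < G.degree x) {r : Fin n} {t : ℕ} (ht : IsMixingTime G r t) (v : Fin n) :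
    G.dist r v ≤ t := by
  set N := ∏ x, G.degree x with hN
  have hN0 : 0 < N := prod_pos fun x _ => hdeg x
  have h1 := ht {v}
  have hv : 0 < graphVolume G {v} := by simpa [graphVolume] using hdeg v
  have hM : 0 < graphVolume G univ := hv.trans_le (graphVolume_mono G (subset_univ _))
  have h2 : (0 : ℝ) < (graphVolume G {v} : ℝ) / (2 * graphVolume G univ) := by
    have : (0 : ℝ) < graphVolume G {v} := by exact_mod_cast hv
    have : (0 : ℝ) < graphVolume G univ := by exact_mod_cast hM
    positivity
  have h3 : 0 < ∑ w : Fin t → Bool × Fin N,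
      (if (List.ofFn w).foldl L.step r ∈ ({v} : Finset (Fin n)) then (1 : ℝ) else 0) := by
    refine lt_of_lt_of_eq ?_ (L.sum_foldl_step hdeg
      (fun x => dvd_prod_of_mem (fun x => G.degree x) (mem_univ x))
      (fun x => if x ∈ ({v} : Finset (Fin n)) then (1 : ℝ) else 0) t r).symm
    have : (0 : ℝ) < N := by exact_mod_cast hN0
    exact mul_pos (by positivity) (h2.trans_le h1)
  obtain ⟨w, -, hw⟩ := exists_ne_zero_of_sum_ne_zero h3.ne'
  have hw' : (List.ofFn w).foldl L.step r = v := by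
    by_contra h
    simp [h] at hw
  have h4 := L.dist_foldl_le hG r (List.ofFn w)
  rwa [hw', List.length_ofFn] at h4

/-- Independence of the walks: the arrays all of whose endpoints miss `B` form the `K`-th power of
the set of single walks that do. -/
theorem IsMixingTime.card_miss_le (L : AdjacencyLists G) (hdeg : ∀ x, 0 < G.degree x) {r : Fin n}
    {t : ℕ} (ht : IsMixingTime G r t) {N : ℕ} (hN : ∀ x, G.degree x ∣ N) (B : Finset (Fin n))
    (K : ℕ) :
    ((univ.filter fun ω : Fin K → Fin t → Bool × Fin N =>
      ∀ i, (List.ofFn (ω i)).foldl L.step r ∉ B).card : ℝ) ≤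
      (1 - (graphVolume G B : ℝ) / (2 * graphVolume G univ)) ^ K *
        Fintype.card (Fin K → Fin t → Bool × Fin N) := by
  set A := univ.filter fun w : Fin t → Bool × Fin N => (List.ofFn w).foldl L.step r ∉ B with hA
  have h1 : (univ.filter fun ω : Fin K → Fin t → Bool × Fin N =>
      ∀ i, (List.ofFn (ω i)).foldl L.step r ∉ B) = Fintype.piFinset fun _ => A := by
    ext ω
    simp [hA]
  have hcard : (Fintype.card (Fin t → Bool × Fin N) : ℝ) = (2 * N) ^ t := by simp
  have h2 : (A.card : ℝ) ≤ (1 - (graphVolume G B : ℝ) / (2 * graphVolume G univ)) *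
      Fintype.card (Fin t → Bool × Fin N) := by
    have h3 := L.sum_foldl_step hdeg hN (fun x => if x ∈ B then 1 else 0) t r
    rw [Finset.sum_boole] at h3
    have h4 := card_filter_add_card_filter_not (s := (univ : Finset (Fin t → Bool × Fin N)))
      (fun w => (List.ofFn w).foldl L.step r ∈ B)
    have h5 : ((univ.filter fun w : Fin t → Bool × Fin N =>
        (List.ofFn w).foldl L.step r ∈ B).card : ℝ) + A.card =
        Fintype.card (Fin t → Bool × Fin N) := by
      exact_mod_cast h4
    have h6 := mul_le_mul_of_nonneg_left (ht B) (by positivity : (0 : ℝ) ≤ (2 * N) ^ t)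
    rw [sub_mul, one_mul, mul_comm (_ / _), hcard]
    rw [hcard] at h5
    linarith
  rw [h1, Fintype.card_piFinset_const, Fintype.card_fun, Fintype.card_fin]
  push_cast
  rw [← mul_pow]
  exact pow_le_pow_left₀ (by positivity) (by simpa using h2) K

/-- The extra `Deg` probe per vertex is absorbed because degrees are positive; hence the factor 2.
-/
theorem annulusCost_le_graphVolume (hdeg : ∀ x, 0 < G.degree x) (v : Fin n) (i j : ℕ) :
    annulusCost G v i j ≤
      2 * graphVolume G (univ.filter fun x => i ≤ G.dist v x ∧ G.dist v x < j) := by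
  rw [annulusCost, graphVolume, mul_sum]
  exact sum_le_sum fun x _ => by have := hdeg x; omega

/-- Around every vertex there is a ball of volume at least `s`, such that a search for any set that
meets the ball has cost at most `2 * s`. -/
theorem exists_ball_annulusCost_le (hdeg : ∀ x, 0 < G.degree x) (v : Fin n) {s : ℝ} (hs : 0 ≤ s)
    (hsG : s ≤ graphVolume G univ) :
    ∃ B : Finset (Fin n), s ≤ graphVolume G B ∧
      ∀ W : Set (Fin n), (∃ x ∈ B, x ∈ W) →
        (annulusCost G v 0 (distToSet G W v) : ℝ) ≤ 2 * s := by
  classical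
  -- The ball of the least radius with volume at least `s` is used: one radius less has volume below
  -- `s`, and the search reads lists only within that smaller ball.
  have hex : ∃ j, s ≤ graphVolume G (univ.filter fun x => G.dist v x ≤ j) := by
    refine ⟨univ.sup (G.dist v), ?_⟩
    have : (univ.filter fun x => G.dist v x ≤ univ.sup (G.dist v)) = univ :=
      filter_true_of_mem fun x _ => le_sup (mem_univ x)
    rwa [this]
  refine ⟨_, Nat.find_spec hex, ?_⟩
  rintro W ⟨x, hx, hxW⟩
  have hm : distToSet G W v ≤ Nat.find hex := (distToSet_le v hxW).trans (by simpa using hx)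
  rcases hj : Nat.find hex with _ | j
  · have : distToSet G W v = 0 := by omega
    rw [this]
    simpa [annulusCost] using hs
  · have h1 := Nat.find_min hex (m := j) (by omega)
    push Not at h1
    have h2 := annulusCost_le_graphVolume hdeg v 0 (distToSet G W v)
    have h3 : graphVolume G (univ.filter fun x => 0 ≤ G.dist v x ∧ G.dist v x < distToSet G W v) ≤
        graphVolume G (univ.filter fun x => G.dist v x ≤ j) := by
      refine graphVolume_mono G fun y hy => ?_
      simp only [mem_filter, mem_univ, true_and] at hy ⊢
      omega
    have h4 : (annulusCost G v 0 (distToSet G W v) : ℝ) ≤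
        2 * graphVolume G (univ.filter fun x => G.dist v x ≤ j) := by
      exact_mod_cast h2.trans (Nat.mul_le_mul_left 2 h3)
    linarith

/-- The collection of walks that is determined by an array of steps. -/
def stepLists {K t N : ℕ} (ω : Fin K → Fin t → Bool × Fin N) : List (List (Bool × Fin N)) :=
  List.ofFn fun i => List.ofFn (ω i)

/-- If some endpoint lands in the ball the search costs at most `2 * s`; otherwise charge twice the
volume of the whole graph, weighted by the probability that all walks miss. -/
theorem IsMixingTime.sum_annulusCost_le (L : AdjacencyLists G) (hdeg : ∀ x, 0 < G.degree x)
    {r : Fin n} {t : ℕ} (ht : IsMixingTime G r t) {N : ℕ} (hN : ∀ x, G.degree x ∣ N) (K : ℕ)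
    (v : Fin n) {s : ℝ} (hs : 0 ≤ s) (hsG : s ≤ graphVolume G univ) :
    ∑ ω : Fin K → Fin t → Bool × Fin N,
      (annulusCost G v 0
        (distToSet G (walkSupport ((stepLists ω).map (L.trace r))) v) : ℝ) ≤
      (2 * s + 2 * graphVolume G univ * (1 - s / (2 * graphVolume G univ)) ^ K) *
        Fintype.card (Fin K → Fin t → Bool × Fin N) := by
  obtain ⟨B, hB, hcost⟩ := exists_ball_annulusCost_le hdeg v hs hsG
  set M : ℝ := (graphVolume G univ : ℝ) with hM
  have hM0 : 0 ≤ M := by positivity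
  have hBM : (graphVolume G B : ℝ) ≤ M := by
    rw [hM]; exact_mod_cast graphVolume_mono G (subset_univ B)
  have hpt : ∀ ω : Fin K → Fin t → Bool × Fin N, (annulusCost G v 0
      (distToSet G (walkSupport ((stepLists ω).map (L.trace r))) v) : ℝ) ≤
      2 * s + 2 * M * if ∀ i, (List.ofFn (ω i)).foldl L.step r ∉ B then 1 else 0 := by
    intro ω
    split_ifs with h
    · have h1 : (annulusCost G v 0
          (distToSet G (walkSupport ((stepLists ω).map (L.trace r))) v) : ℝ) ≤ 2 * M := by
        rw [hM]
        exact_mod_cast (annulusCost_le_graphVolume hdeg v 0 _).trans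
          (Nat.mul_le_mul_left 2 (graphVolume_mono G (subset_univ _)))
      linarith
    · push Not at h
      obtain ⟨i, hi⟩ := h
      rw [mul_zero, add_zero]
      refine hcost _ ⟨_, hi, _, List.mem_map_of_mem (List.mem_ofFn.2 ⟨i, rfl⟩), ?_⟩
      exact L.foldl_mem_trace r _
  refine (sum_le_sum fun ω _ => hpt ω).trans ?_
  rw [sum_add_distrib, sum_const, card_univ, nsmul_eq_mul, ← mul_sum, Finset.sum_boole, add_mul,
    mul_comm _ (2 * s), mul_assoc (2 * M)]
  refine add_le_add_right (mul_le_mul_of_nonneg_left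
    ((ht.card_miss_le L hdeg hN B K).trans ?_) (by positivity)) _
  refine mul_le_mul_of_nonneg_right (pow_le_pow_left₀ ?_ ?_ K) (by positivity)
  · have : (graphVolume G B : ℝ) / (2 * M) ≤ 1 := div_le_one_of_le₀ (by linarith) (by positivity)
    linarith
  · have : s / (2 * M) ≤ (graphVolume G B : ℝ) / (2 * M) := by gcongr
    linarith

end WalkDistribution

/-! ### The algorithm and its parameters -/

section WalkTreeLCA

open Finset

/-- The length of the walks. -/
noncomputable def walkLength (n : ℕ) (φ : ℝ) : ℕ := ⌈32 * (Real.log n / φ ^ 2)⌉₊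

/-- The number of walks. -/
noncomputable def walkCount (n : ℕ) : ℕ := ⌈Real.sqrt n * Real.log n⌉₊

/-- The steps of all walks.  Reducing a uniform element of `Fin d !` modulo a degree that is at most
`d` gives a uniform position in an adjacency list. -/
abbrev WalkSteps (n d : ℕ) (φ : ℝ) : Type :=
  Fin (walkCount n) → Fin (walkLength n φ) → Bool × Fin d.factorial

instance (n d : ℕ) (φ : ℝ) : Nonempty (WalkSteps n d φ) :=
  ⟨fun _ _ => (true, ⟨0, d.factorial_pos⟩)⟩

/-- The algorithm that spans a tree by random walks from the vertex `0`, and joins every other vertex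
to these walks by a shortest path. -/
noncomputable def walkTreeLCA (n d : ℕ) (φ : ℝ) : EdgeLCA n where
  numBits := (exists_bitSampler (WalkSteps n d φ)).choose
  strategy R u v := ProbeTree.treeQuery ⟨0, u.pos⟩ (walkLength n φ)
    (stepLists ((exists_bitSampler (WalkSteps n d φ)).choose_spec.choose R)) u v

/-- Allows the `+ 1` from each rounding up to be absorbed into the main term. -/
theorem half_lt_log_of_two_le {n : ℕ} (hn : 2 ≤ n) : 1 / 2 < Real.log n := by
  have h1 : Real.log 2 ≤ Real.log n :=
    Real.log_le_log (by norm_num) (by exact_mod_cast hn)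
  linarith [Real.log_two_gt_d9]

variable {n d : ℕ} {φ : ℝ}

theorem walkCount_pos (hn : 2 ≤ n) : 0 < walkCount n := by
  have := half_lt_log_of_two_le hn
  have : (0 : ℝ) < n := by exact_mod_cast (by omega : 0 < n)
  exact Nat.ceil_pos.2 (by positivity)

theorem walkCount_le (hn : 2 ≤ n) : (walkCount n : ℝ) ≤ 3 * (Real.sqrt n * Real.log n) := by
  have h1 := half_lt_log_of_two_le hn
  have h2 : (1 : ℝ) ≤ Real.sqrt n :=
    Real.one_le_sqrt.2 (by exact_mod_cast (by omega : 1 ≤ n))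
  have h3 := Nat.ceil_lt_add_one (a := Real.sqrt n * Real.log n) (by positivity)
  have h4 : (walkCount n : ℝ) < Real.sqrt n * Real.log n + 1 := h3
  nlinarith

theorem walkLength_le (hn : 2 ≤ n) (hφ : 0 < φ) (hφ1 : φ ≤ 1) :
    (walkLength n φ : ℝ) ≤ 34 * (Real.log n / φ ^ 2) := by
  have h1 := half_lt_log_of_two_le hn
  have h2 : Real.log n ≤ Real.log n / φ ^ 2 :=
    le_div_self (by linarith) (by positivity) (pow_le_one₀ hφ.le hφ1)
  have h3 := Nat.ceil_lt_add_one (a := 32 * (Real.log n / φ ^ 2)) (by linarith)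
  have h4 : (walkLength n φ : ℝ) < 32 * (Real.log n / φ ^ 2) + 1 := h3
  linarith

variable {G : SimpleGraph (Fin n)} [DecidableRel G.Adj]

theorem isMixingTime_walkLength (hn : 2 ≤ n) (hφ : 0 < φ) (hφ1 : φ ≤ 1) (hG : HasExpansion G φ)
    (hdeg : ∀ x, 0 < G.degree x) (r : Fin n) : IsMixingTime G r (walkLength n φ) := by
  intro B
  refine hG.iterate_lazyWalkOp_indicator_ge hφ.le hφ1 hdeg _ ?_ B r
  have hn0 : (0 : ℝ) < n := by exact_mod_cast (by omega : 0 < n)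
  have hn2 : (2 : ℝ) ≤ n := by exact_mod_cast hn
  have hM : (graphVolume G univ : ℝ) ≤ n ^ 2 := by
    have : graphVolume G univ ≤ ∑ _v : Fin n, n :=
      sum_le_sum fun v _ => by simpa using (G.degree_lt_card_verts v).le
    have h : graphVolume G univ ≤ n ^ 2 := this.trans (by simp [sq])
    exact_mod_cast h
  -- The constant 32 yields decay `n⁻⁸`, which beats `4 * M ^ 3` through `M ≤ n ^ 2` and `4 ≤ n ^
  -- 2`.
  have hl : 8 * Real.log n ≤ φ ^ 2 / 4 * walkLength n φ := by
    have h1 : 32 * (Real.log n / φ ^ 2) ≤ walkLength n φ := Nat.le_ceil _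
    have h2 := mul_le_mul_of_nonneg_left h1 (by positivity : 0 ≤ φ ^ 2 / 4)
    refine le_trans (le_of_eq ?_) h2
    field_simp
    ring
  have hq : (1 - φ ^ 2 / 4) ^ walkLength n φ ≤ ((n : ℝ) ^ 8)⁻¹ := by
    calc (1 - φ ^ 2 / 4) ^ walkLength n φ
        ≤ Real.exp (-(φ ^ 2 / 4)) ^ walkLength n φ :=
          pow_le_pow_left₀ (by nlinarith) (Real.one_sub_le_exp_neg _) _
      _ = Real.exp (-(φ ^ 2 / 4 * walkLength n φ)) := by
          rw [← Real.exp_nat_mul]; ring_nf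
      _ ≤ Real.exp (-(8 * Real.log n)) := Real.exp_le_exp.2 (by linarith)
      _ = ((n : ℝ) ^ 8)⁻¹ := by
          rw [Real.exp_neg, show (8 : ℝ) * Real.log n = (8 : ℕ) * Real.log n by norm_num,
            Real.exp_nat_mul, Real.exp_log hn0]
  calc (1 - φ ^ 2 / 4) ^ walkLength n φ * (4 * (graphVolume G univ : ℝ) ^ 3)
      ≤ ((n : ℝ) ^ 8)⁻¹ * (n ^ 2 * ((n : ℝ) ^ 2) ^ 3) := by
        gcongr
        nlinarith
    _ = 1 := by field_simp

/-- Take `s = 2 √n d`. A hit costs at most `4 √n d`, and misses contribute at most `2 n d * (1 / n)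
= 2 d`. If the whole volume is below `s`, reading the entire graph is already cheap enough. -/
theorem sum_annulusCost_walkSteps_le (L : AdjacencyLists G) (hn : 2 ≤ n)
    (hdeg : ∀ x, 0 < G.degree x) (hd : ∀ x, G.degree x ≤ d) {r : Fin n}
    (hmix : IsMixingTime G r (walkLength n φ)) (v : Fin n) :
    ∑ ω : WalkSteps n d φ,
      (annulusCost G v 0
        (distToSet G (walkSupport ((stepLists ω).map (L.trace r))) v) : ℝ) ≤
      6 * (Real.sqrt n * d) * Fintype.card (WalkSteps n d φ) := by
  have hn0 : (0 : ℝ) < n := by exact_mod_cast (by omega : 0 < n)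
  have hsqrt : (1 : ℝ) ≤ Real.sqrt n :=
    Real.one_le_sqrt.2 (by exact_mod_cast (by omega : 1 ≤ n))
  have hd1 : (1 : ℝ) ≤ d := by exact_mod_cast (hdeg v).trans_le (hd v)
  set M : ℝ := (graphVolume G univ : ℝ) with hM
  have hMn : M ≤ n * d := by
    have : graphVolume G univ ≤ ∑ _v : Fin n, d := sum_le_sum fun v _ => hd v
    have h : graphVolume G univ ≤ n * d := this.trans (by simp)
    rw [hM]
    exact_mod_cast h
  rcases le_total (2 * (Real.sqrt n * d)) M with hs | hs
  · have hM0 : 0 < M := lt_of_lt_of_le (by positivity) hs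
    refine (hmix.sum_annulusCost_le L hdeg
      (fun x => Nat.dvd_factorial (hdeg x) (hd x)) (walkCount n) v (by positivity) hs).trans ?_
    refine mul_le_mul_of_nonneg_right ?_ (by positivity)
    have hβ : 1 / Real.sqrt n ≤ 2 * (Real.sqrt n * d) / (2 * M) := by
      rw [div_le_div_iff₀ (by positivity) (by positivity)]
      have := Real.mul_self_sqrt hn0.le
      nlinarith
    have h1 : 2 * (Real.sqrt n * d) / (2 * M) ≤ 1 :=
      div_le_one_of_le₀ (by linarith) (by positivity)
    have hq : (1 - 2 * (Real.sqrt n * d) / (2 * M)) ^ walkCount n ≤ 1 / n := by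
      have h2 : Real.log n ≤ walkCount n * (1 / Real.sqrt n) := by
        have h3 : Real.sqrt n * Real.log n ≤ walkCount n := Nat.le_ceil _
        rw [mul_one_div, le_div_iff₀ (by positivity)]
        linarith
      calc (1 - 2 * (Real.sqrt n * d) / (2 * M)) ^ walkCount n
          ≤ Real.exp (-(1 / Real.sqrt n)) ^ walkCount n :=
            pow_le_pow_left₀ (by linarith)
              (le_trans (by linarith) (Real.one_sub_le_exp_neg _)) _
        _ = Real.exp (-(walkCount n * (1 / Real.sqrt n))) := by
            rw [← Real.exp_nat_mul]; ring_nf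
        _ ≤ Real.exp (-Real.log n) := Real.exp_le_exp.2 (by linarith)
        _ = 1 / n := by rw [Real.exp_neg, Real.exp_log hn0, one_div]
    have h4 : 2 * M * (1 - 2 * (Real.sqrt n * d) / (2 * M)) ^ walkCount n ≤ 2 * d := by
      calc _ ≤ 2 * (n * d) * (1 / (n : ℝ)) :=
            mul_le_mul (by linarith) hq (pow_nonneg (by linarith) _) (by positivity)
        _ = 2 * d := by field_simp
    nlinarith
  · calc _ ≤ ∑ _ω : WalkSteps n d φ, 2 * M := sum_le_sum fun ω _ => by
          rw [hM]
          exact_mod_cast (annulusCost_le_graphVolume hdeg v 0 _).trans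
            (Nat.mul_le_mul_left 2 (graphVolume_mono G (subset_univ _)))
      _ = 2 * M * Fintype.card (WalkSteps n d φ) := by
          rw [sum_const, card_univ, nsmul_eq_mul, mul_comm]
      _ ≤ _ := by
          refine mul_le_mul_of_nonneg_right ?_ (by positivity)
          nlinarith

end WalkTreeLCA

/-! ### Assembly of the main theorem -/

theorem theorem1p4 :
    ∃ C : ℝ, 0 < C ∧
    ∃ A : (n : ℕ) → (d : ℕ) → (φ : ℝ) → EdgeLCA n,
    ∀ (n d : ℕ) (φ : ℝ), 2 ≤ n → 0 < φ →
    ∀ (G : SimpleGraph (Fin n)) [DecidableRel G.Adj] (L : AdjacencyLists G),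
      G.Connected → (∀ v, G.degree v ≤ d) → φ ≤ graphConductance G →
      ∃ T : (Fin (A n d φ).numBits → Bool) → SimpleGraph (Fin n),
        (A n d φ).AnswersMembership L T ∧
        1 - 1 / (n : ℝ) ≤ bitProb (A n d φ).numBits (fun R => (T R).IsTree) ∧
        (∀ R, (T R).IsTree →
          HasDepthAtMost (T R) (C * (Real.log n / φ ^ 2)) ∧
          IsSpanner G (T R) (C * (Real.log n / φ ^ 2))) ∧
        ∀ u v : Fin n, G.Adj u v →
          (A n d φ).expectedProbes L u v ≤
            C * (Real.sqrt n * (Real.log n ^ 2 / φ ^ 2 + d)) := by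
  -- `408 = 2 * 2 * 34 * 3`: the sampler's factor, two probes per walk step, and the constants of
  -- `walkLength_le` and `walkCount_le`. Depth and stretch need only `4 * 34`, and the `d` term only
  -- `2 * 12`.
  refine ⟨408, by norm_num, walkTreeLCA, fun n d φ hn hφ G _ L hG hd hcond => ?_⟩
  have : Nontrivial (Fin n) := Fin.nontrivial_iff_two_le.2 hn
  have hφ1 : φ ≤ 1 := hcond.trans (graphConductance_le_one G)
  have hdeg : ∀ x, 0 < G.degree x := fun x =>
    hG.preconnected.degree_pos_of_nontrivial x
  let r : Fin n := ⟨0, by omega⟩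
  have hmix : IsMixingTime G r (walkLength n φ) :=
    isMixingTime_walkLength hn hφ hφ1 (hasExpansion_of_le_graphConductance G hcond) hdeg r
  have hstep : ∀ ω : WalkSteps n d φ, (stepLists ω).length = walkCount n := fun ω => by
    simp [stepLists]
  have htree := fun ω : WalkSteps n d φ => exists_tree_of_walks L hG (r := r)
    (l := walkLength n φ) (ss := stepLists ω)
    (by
      rw [← List.length_pos_iff, hstep]
      exact walkCount_pos hn)
    (by
      intro s hs
      obtain ⟨i, rfl⟩ := List.mem_ofFn.1 hs
      simp)
    (hmix.dist_le L hG hdeg)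
  choose T hle hT hshape hquery using htree
  let f := (exists_bitSampler (WalkSteps n d φ)).choose_spec.choose
  have hf := (exists_bitSampler (WalkSteps n d φ)).choose_spec.choose_spec
  have hlog := half_lt_log_of_two_le hn
  have hlen := walkLength_le hn hφ hφ1
  refine ⟨fun R => T (f R), fun R => ⟨hle _, fun u v huv => (hquery (f R) u v huv).1⟩, ?_, ?_, ?_⟩
  -- Every random string yields a tree, so the probability is exactly 1.
  · have : bitProb (walkTreeLCA n d φ).numBits (fun R => (T (f R)).IsTree) = 1 := by
      simp [bitProb, hT]
    rw [this]
    have : (0 : ℝ) ≤ 1 / n := by positivity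
    linarith
  · intro R _
    refine hshape (f R) _ ?_
    have : 0 ≤ Real.log n / φ ^ 2 := by positivity
    linarith
  · intro u v huv
    let g : WalkSteps n d φ → ℝ := fun ω =>
      ((ProbeTree.treeQuery r (walkLength n φ) (stepLists ω) u v).probes L : ℝ)
    have h1 : (walkTreeLCA n d φ).expectedProbes L u v ≤
        2 * ((∑ ω, g ω) / Fintype.card (WalkSteps n d φ)) :=
      hf g fun ω => Nat.cast_nonneg _
    have hcard : (0 : ℝ) < Fintype.card (WalkSteps n d φ) := by exact_mod_cast Fintype.card_pos
    have h2 : ∑ ω, g ω ≤ (2 * walkLength n φ * walkCount n + 12 * (Real.sqrt n * d)) *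
        Fintype.card (WalkSteps n d φ) := by
      have h3 : ∀ ω, g ω ≤ 2 * walkLength n φ * walkCount n +
          (annulusCost G u 0 (distToSet G (walkSupport ((stepLists ω).map (L.trace r))) u) : ℝ) +
          annulusCost G v 0 (distToSet G (walkSupport ((stepLists ω).map (L.trace r))) v) := by
        intro ω
        have h4 := (hquery ω u v huv).2
        rw [hstep] at h4
        simp only [g]
        exact_mod_cast h4
      refine (Finset.sum_le_sum fun ω _ => h3 ω).trans ?_
      rw [Finset.sum_add_distrib, Finset.sum_add_distrib, Finset.sum_const, Finset.card_univ,
        nsmul_eq_mul]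
      have hu := sum_annulusCost_walkSteps_le L hn hdeg hd hmix u
      have hv := sum_annulusCost_walkSteps_le L hn hdeg hd hmix v
      linarith
    have h5 := (div_le_iff₀ hcard).2 h2
    have h6 : (walkLength n φ : ℝ) * walkCount n ≤
        34 * (Real.log n / φ ^ 2) * (3 * (Real.sqrt n * Real.log n)) :=
      mul_le_mul hlen (walkCount_le hn) (by positivity) (by positivity)
    have h7 : 34 * (Real.log n / φ ^ 2) * (3 * (Real.sqrt n * Real.log n)) =
        102 * (Real.sqrt n * (Real.log n ^ 2 / φ ^ 2)) := by ring
    have h8 : 0 ≤ Real.sqrt n * d := by positivity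
    rw [mul_add]
    linarith
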